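/- Let $H\in\mathbb{R}[x,y]$ be a polynomial of degree $n$ with $H(0,0)=0$ and let $X_H=(-\partial_yH,\partial_xH)$ be its Hamiltonian vector field. Consider on the torus $\mathbb{T}^2=\mathbb{R}^2/\mathbb{Z}^2$, obtained from the unit square $[0,1]^2$ by gluing opposite edges, the piecewise smooth vector field $X$ that equals $X_H$ on $(0,1)^2$, with switching set $\Sigma=\partial[0,1]^2$; at a point of $\Sigma$ other than the vertex, the two one-sided values of $X$ are the values of $X_H$ at the two boundary points of the square glued there, and the point is a sewing point if the components of these two values along a common normal to $\Sigma$ have a positive product. A crossing closed orbit is a closed orbit consisting of finitely many (at least one) trajectory arcs of $X_H$ in the square, each running inside $(0,1)^2$ between two non-vertex boundary points, where the end of each arc is glued to the start of the next one at a sewing point. A crossing limit cycle is a crossing closed orbit that is the only crossing closed orbit contained in some neighbourhood of itself. It is of type aba with transition points $p_1=(0,y_1)$, $p_2=(x_1,1)$, $p_3=(x_1,0)$, $p_4=(1,y_1)$, where $x_1,y_1\in(0,1)$, if it consists of an arc joining $p_1$ and $p_2$ and an arc joining $p_3$ and $p_4$, sewn at $p_2\sim p_3$ and $p_4\sim p_1$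 (travelled as $p_1\to p_2\sim p_3\to p_4\sim p_1$ or in the opposite direction). Assume that for each crossing limit cycle $\gamma$ of type aba, with transition points $p_1,\dots,p_4$, one has $\min_{\gamma}\|\nabla H\|>0$ and $\langle X_H(p_i),n_{p_i}\rangle\neq 0$ for $i=1,2,3,4$, where $n_{p_i}$ is the inward-pointing unit normal to $\partial[0,1]^2$ at $p_i$. Then $X$ has at most $n(n-1)$ crossing limit cycles of type aba. -/

import Mathlib

namespace TorusPSVF

/-- The torus `ℝ² / ℤ²`, i.e. the unit square with opposite edges identified. -/
abbrev Torus : Type := UnitAddCircle × UnitAddCircle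

/-- The quotient map; restricted to the closed unit square it glues opposite edges. -/
def toTorus (p : ℝ × ℝ) : Torus := ((p.1 : UnitAddCircle), (p.2 : UnitAddCircle))

/-- The dot product of the plane. -/
def dot (v w : ℝ × ℝ) : ℝ := v.1 * w.1 + v.2 * w.2

/-- The value `H(p)` of a real polynomial in two variables. -/
noncomputable def value (H : MvPolynomial (Fin 2) ℝ) (p : ℝ × ℝ) : ℝ :=
  MvPolynomial.eval ![p.1, p.2] H

/-- The gradient `(∂H/∂x, ∂H/∂y)`. -/
noncomputable def grad (H : MvPolynomial (Fin 2) ℝ) (p : ℝ × ℝ) : ℝ × ℝ :=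
  (value (MvPolynomial.pderiv 0 H) p, value (MvPolynomial.pderiv 1 H) p)

/-- The Hamiltonian vector field `X_H = (-∂H/∂y, ∂H/∂x)`.  On the closed unit square it gives the
piecewise smooth field on the torus: at a point of an edge it is the one-sided limit, from the open
square, of the field at that edge, so at a point of the switching set `Σ` which is not the vertex
the two one-sided values are the values of `X_H` at the two boundary points glued there. -/
noncomputable def X (H : MvPolynomial (Fin 2) ℝ) (p : ℝ × ℝ) : ℝ × ℝ :=
  (-(grad H p).2, (grad H p).1)

/-- The open unit square. -/
def openSquare : Set (ℝ × ℝ) := Set.Ioo 0 1 ×ˢ Set.Ioo 0 1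

/-- The boundary of the unit square without the four vertices. -/
def edges : Set (ℝ × ℝ) := {p |
  ((p.1 = 0 ∨ p.1 = 1) ∧ p.2 ∈ Set.Ioo (0 : ℝ) 1) ∨
  (p.1 ∈ Set.Ioo (0 : ℝ) 1 ∧ (p.2 = 0 ∨ p.2 = 1))}

open Classical in
/-- The inward-pointing unit normal of the boundary of the unit square, at a point of `edges`. -/
noncomputable def inwardNormal (p : ℝ × ℝ) : ℝ × ℝ :=
  if p.1 = 0 then (1, 0) else if p.1 = 1 then (-1, 0) else if p.2 = 0 then (0, 1) else (0, -1)

/-- `p` and `q` are the two boundary points (not vertices) glued to one point of the switching set,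
and this point belongs to the sewing region: the two one-sided values of the field have normal
components of the same nonzero sign with respect to a common normal. -/
def Sewn (H : MvPolynomial (Fin 2) ℝ) (p q : ℝ × ℝ) : Prop :=
  p ∈ edges ∧ q ∈ edges ∧ p ≠ q ∧ toTorus p = toTorus q ∧
    0 < dot (X H p) (inwardNormal p) * dot (X H q) (inwardNormal p)

/-- `S` is the trace of a trajectory of `X_H` that starts at `p` on the boundary, ends at `q` on the
boundary, and stays in the open unit square in between. -/
def IsArc (H : MvPolynomial (Fin 2) ℝ) (p q : ℝ × ℝ) (S : Set (ℝ × ℝ)) : Prop :=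
  p ∈ edges ∧ q ∈ edges ∧ ∃ (T : ℝ) (φ : ℝ → ℝ × ℝ), 0 < T ∧ φ 0 = p ∧ φ T = q ∧
    (∀ t ∈ Set.Icc 0 T, HasDerivWithinAt φ (X H (φ t)) (Set.Icc 0 T) t) ∧
    (∀ t ∈ Set.Ioo 0 T, φ t ∈ openSquare) ∧ S = φ '' Set.Icc 0 T

/-- `γ` is a closed orbit on the torus that meets the switching set, and meets it only at points of
the sewing region: a cyclic concatenation of `k + 1` arcs (addition in `Fin (k + 1)` is modulo
`k + 1`), where the end of each arc is sewn to the start of the next one. -/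
def IsCrossingClosedOrbit (H : MvPolynomial (Fin 2) ℝ) (γ : Set Torus) : Prop :=
  ∃ (k : ℕ) (p q : Fin (k + 1) → ℝ × ℝ) (S : Fin (k + 1) → Set (ℝ × ℝ)),
    (∀ i, IsArc H (p i) (q i) (S i)) ∧ (∀ i, Sewn H (q i) (p (i + 1))) ∧
    γ = toTorus '' ⋃ i, S i

/-- A crossing closed orbit that is the only one in some neighbourhood of itself. -/
def IsCrossingLimitCycle (H : MvPolynomial (Fin 2) ℝ) (γ : Set Torus) : Prop :=
  IsCrossingClosedOrbit H γ ∧ ∃ U : Set Torus, IsOpen U ∧ γ ⊆ U ∧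
    ∀ γ' : Set Torus, IsCrossingClosedOrbit H γ' → γ' ⊆ U → γ' = γ

/-- `S`, a subset of the closed unit square, is the trace of a crossing closed orbit of type aba
with transition points `(0, y)`, `(x, 1)`, `(x, 0)`, `(1, y)`: one arc joins `(0, y)` and `(x, 1)`,
one arc joins `(x, 0)` and `(1, y)`, both run in this direction or both in the opposite one, and the
four points are sewn in pairs.  Either direction of travel is allowed. -/
def IsABACycle (H : MvPolynomial (Fin 2) ℝ) (x y : ℝ) (S : Set (ℝ × ℝ)) : Prop :=
  Sewn H (x, 1) (x, 0) ∧ Sewn H (1, y) (0, y) ∧ ∃ S₁ S₂ : Set (ℝ × ℝ), S = S₁ ∪ S₂ ∧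
    ((IsArc H (0, y) (x, 1) S₁ ∧ IsArc H (x, 0) (1, y) S₂) ∨
      (IsArc H (x, 1) (0, y) S₁ ∧ IsArc H (1, y) (x, 0) S₂))

/-- `S` is the trace in the closed unit square of a crossing limit cycle of type aba with transition
points `(0, y)`, `(x, 1)`, `(x, 0)`, `(1, y)`. -/
def IsABALimitCycle (H : MvPolynomial (Fin 2) ℝ) (x y : ℝ) (S : Set (ℝ × ℝ)) : Prop :=
  IsABACycle H x y S ∧ IsCrossingLimitCycle H (toTorus '' S)

end TorusPSVF

/-! ### Bézout's inequality for coprime real polynomials in two variables. -/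

section

open MvPolynomial

/-! `H` is constant along arcs, so the transition coordinates of an aba cycle solve `P = H(0,y) -
H(x,1) = 0` and `Q = H(x,0) - H(1,y) = 0`. Both have degree at most `n`, but in `P + Q` pure powers
contribute only constants and mixed monomials lose degree, so `P + Q` has degree at most `n - 1`
(`totalDegree_transition_add_le`). Bézout for `P` and `P + Q` would give `n(n-1)`, were there no
common components.

Isolation of limit cycles takes care of those. Orbits transversal to the boundary persist, so every
solution of the system near the given one comes from a nearby aba cycle; hence the transition
coordinates of a limit cycle are an isolated common zero (`IsABALimitCycle.isolated`). Sewing gives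
`∂P/∂y = ∂H/∂y(0,y) ≠ 0` there. If a common factor vanished at that point, its `y`-derivative would
be nonzero and it would have zeros accumulating there, contrary to isolation. The common factor can
therefore be divided out (`encard_isolated_zeros_le`). Finally the coordinates determine the cycle
(`IsABACycle.unique`). -/

theorem MvPolynomial.finrank_restrictTotalDegree_fin_two (d : ℕ) :
    Module.finrank ℝ (restrictTotalDegree (Fin 2) ℝ d) = ∑ i ∈ Finset.range (d + 1), (i + 1) := by
  have h := Module.finrank_eq_nat_card_basis
    (basisRestrictSupport ℝ {n : Fin 2 →₀ ℕ | (n.sum fun _ e => e) ≤ d})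
  have h2 : Module.finrank ℝ (restrictTotalDegree (Fin 2) ℝ d)
    = Nat.card {n : Fin 2 →₀ ℕ | (n.sum fun _ e => e) ≤ d} := h
  rw [h2]
  let e : {n : Fin 2 →₀ ℕ | (n.sum fun _ e => e) ≤ d} ≃
      ((Finset.range (d + 1)).sigma fun i => Finset.HasAntidiagonal.antidiagonal i) :=
    { toFun := fun n => ⟨⟨n.1 0 + n.1 1, (n.1 0, n.1 1)⟩, by
        have := n.2
        simp [Finsupp.sum_fintype] at this ⊢
        omega⟩
      invFun := fun z => ⟨Finsupp.equivFunOnFinite.symm ![z.1.2.1, z.1.2.2], by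
        obtain ⟨⟨i, a, b⟩, hz⟩ := z
        simp only [Finset.mem_sigma, Finset.mem_range, Finset.HasAntidiagonal.mem_antidiagonal] at hz
        simp [Finsupp.sum_fintype]
        omega⟩
      left_inv := fun n => by
        ext i
        fin_cases i <;> simp
      right_inv := fun z => by
        obtain ⟨⟨i, a, b⟩, hz⟩ := z
        simp at hz
        obtain ⟨_, rfl⟩ := hz
        simp }
  rw [Nat.card_congr e, Nat.card_eq_fintype_card, Fintype.card_coe, Finset.card_sigma]
  simp

/-- A product of affine forms, one for each point of `s`, each separating that point from `v`. It
makes evaluation on `s` surjective from degree `s.card` on. -/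
theorem MvPolynomial.exists_eval_eq_one_of_finset (s : Finset (Fin 2 → ℝ)) (v : Fin 2 → ℝ) :
    ∃ p : MvPolynomial (Fin 2) ℝ, p.totalDegree ≤ s.card ∧ eval v p = 1 ∧
      ∀ w ∈ s, w ≠ v → eval w p = 0 := by
  classical
  have key : ∀ w : Fin 2 → ℝ, ∃ l : MvPolynomial (Fin 2) ℝ, l.totalDegree ≤ 1 ∧ eval v l = 1 ∧
      (w ≠ v → eval w l = 0) := by
    intro w
    by_cases h : w = v
    · exact ⟨1, by simp, by simp, fun h' => absurd h h'⟩
    · obtain ⟨i, hi⟩ := Function.ne_iff.1 h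
      refine ⟨C (v i - w i)⁻¹ * (X i - C (w i)), ?_, ?_, ?_⟩
      · refine (totalDegree_mul _ _).trans ?_
        have := totalDegree_sub_C_le (X i : MvPolynomial (Fin 2) ℝ) (w i)
        simpa using this
      · have : v i - w i ≠ 0 := sub_ne_zero.2 (Ne.symm hi)
        simp [this]
      · simp
  choose l h1 h2 h3 using key
  refine ⟨∏ w ∈ s, l w, ?_, ?_, ?_⟩
  · refine (totalDegree_finsetProd _ _).trans ?_
    simpa using Finset.sum_le_sum (fun w (_ : w ∈ s) => h1 w)
  · simp [map_prod, h2]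
  · intro w hw hwv
    rw [map_prod]
    exact Finset.prod_eq_zero hw (h3 w hwv)

theorem MvPolynomial.finrank_map_mulLeft_restrictTotalDegree {A : MvPolynomial (Fin 2) ℝ}
    (hA : A ≠ 0) (d : ℕ) :
    Module.finrank ℝ ((restrictTotalDegree (Fin 2) ℝ d).map (LinearMap.mulLeft ℝ A))
      = ∑ i ∈ Finset.range (d + 1), (i + 1) := by
  rw [← finrank_restrictTotalDegree_fin_two d]
  exact (Submodule.equivMapOfInjective _ (mul_right_injective₀ hA) _).finrank_eq.symm

/-- Dimension count, with `R d` the polynomials of degree at most `d`. Evaluation on `s` maps `R (a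
+ b + c)` onto a space of dimension `c`, and its kernel contains `A · R (b + c) + B · R (a + c)`,
whose two summands meet inside `AB · R c`. -/
theorem MvPolynomial.card_le_of_forall_eval_eq_zero {A B : MvPolynomial (Fin 2) ℝ} (hA : A ≠ 0)
    (hB : B ≠ 0) (hAB : IsRelPrime A B) (s : Finset (Fin 2 → ℝ))
    (hs : ∀ v ∈ s, eval v A = 0 ∧ eval v B = 0) :
    s.card ≤ A.totalDegree * B.totalDegree := by
  classical
  set a := A.totalDegree with ha
  set b := B.totalDegree with hb
  set c := s.card with hc
  let R : ℕ → Submodule ℝ (MvPolynomial (Fin 2) ℝ) := fun d => restrictTotalDegree (Fin 2) ℝ d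
  let M := (R (b + c)).map (LinearMap.mulLeft ℝ A)
  let N := (R (a + c)).map (LinearMap.mulLeft ℝ B)
  have hM : Module.finrank ℝ M = _ := finrank_map_mulLeft_restrictTotalDegree hA (b + c)
  have hN : Module.finrank ℝ N = _ := finrank_map_mulLeft_restrictTotalDegree hB (a + c)
  have hsum := Submodule.finrank_sup_add_finrank_inf_eq M N
  have hinf : Module.finrank ℝ ↥(M ⊓ N) ≤ ∑ i ∈ Finset.range (c + 1), (i + 1) := by
    rw [← finrank_map_mulLeft_restrictTotalDegree (mul_ne_zero hA hB) c]
    refine Submodule.finrank_mono ?_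
    rintro p ⟨⟨u, hu, rfl⟩, ⟨w, hw, hp⟩⟩
    simp only [LinearMap.mulLeft_apply] at hp
    have hdvd : B ∣ u := by
      refine (hAB.symm).dvd_of_dvd_mul_left (Dvd.intro w hp)
    obtain ⟨r, rfl⟩ := hdvd
    refine ⟨r, ?_, by simp⟩
    by_cases hr : r = 0
    · simp [hr]
    simp only [R, SetLike.mem_coe, mem_restrictTotalDegree] at hu ⊢
    rw [totalDegree_mul_of_isDomain hB hr] at hu
    omega
  let ev : R (a + b + c) →ₗ[ℝ] (s → ℝ) :=
    (LinearMap.pi fun v : s => (aeval (v : Fin 2 → ℝ)).toLinearMap) ∘ₗ (R (a + b + c)).subtype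
  have hev : ∀ (p : R (a + b + c)) (v : s), ev p v = eval (v : Fin 2 → ℝ) (p : MvPolynomial _ ℝ) := by
    intro p v
    simp [ev, aeval_eq_eval]
  have hsurj : LinearMap.range ev = ⊤ := by
    rw [LinearMap.range_eq_top]
    intro f
    choose l h1 h2 h3 using fun v : Fin 2 → ℝ => exists_eval_eq_one_of_finset s v
    have hmem : ∀ v, l v ∈ R (a + b + c) := fun v => by
      simp only [R, mem_restrictTotalDegree]
      have := h1 v
      omega
    refine ⟨∑ v : s, f v • (⟨l v, hmem v⟩ : R (a + b + c)), ?_⟩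
    ext v
    rw [map_sum, Finset.sum_apply, Finset.sum_eq_single v]
    · rw [map_smul, Pi.smul_apply, hev]
      simp [h2]
    · intro w _ hwv
      rw [map_smul, Pi.smul_apply, hev]
      simp only [smul_eq_mul, mul_eq_zero]
      right
      exact h3 _ _ v.2 (fun h => hwv (Subtype.ext h.symm))
    · simp
  have hrank := ev.finrank_range_add_finrank_ker
  rw [hsurj, finrank_top, Module.finrank_fintype_fun_eq_card, Fintype.card_coe,
    finrank_restrictTotalDegree_fin_two] at hrank
  have hker : Module.finrank ℝ ↥(M ⊔ N) ≤ Module.finrank ℝ (LinearMap.ker ev) := by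
    rw [(Submodule.equivMapOfInjective _ (R (a + b + c)).subtype_injective
      (LinearMap.ker ev)).finrank_eq]
    refine Submodule.finrank_mono (sup_le ?_ ?_)
    · rintro _ ⟨u, hu, rfl⟩
      simp only [R, SetLike.mem_coe, mem_restrictTotalDegree] at hu
      refine ⟨⟨A * u, ?_⟩, ?_, rfl⟩
      · simp only [R, mem_restrictTotalDegree]
        exact (totalDegree_mul _ _).trans (by omega)
      · rw [SetLike.mem_coe, LinearMap.mem_ker]
        ext v
        rw [hev]
        simp [(hs v v.2).1]
    · rintro _ ⟨u, hu, rfl⟩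
      simp only [R, SetLike.mem_coe, mem_restrictTotalDegree] at hu
      refine ⟨⟨B * u, ?_⟩, ?_, rfl⟩
      · simp only [R, mem_restrictTotalDegree]
        exact (totalDegree_mul _ _).trans (by omega)
      · rw [SetLike.mem_coe, LinearMap.mem_ker]
        ext v
        rw [hev]
        simp [(hs v v.2).2]
  have hD : ∀ d : ℕ, (∑ i ∈ Finset.range (d + 1), (i + 1)) * 2 = (d + 1) * (d + 2) := by
    intro d
    induction d with
    | zero => simp
    | succ d ih => rw [Finset.sum_range_succ, add_mul, ih]; ring
  -- With `D(d) = (d+1)(d+2)/2`, the count is `D(a+b+c) - D(a+c) - D(b+c) + D(c) = ab`.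
  have e1 := hD c
  have e2 := hD (b + c)
  have e3 := hD (a + c)
  have e4 := hD (a + b + c)
  nlinarith

theorem MvPolynomial.encard_setOf_eval_eq_zero_le {A B : MvPolynomial (Fin 2) ℝ} (hA : A ≠ 0)
    (hB : B ≠ 0) (hAB : IsRelPrime A B) :
    {v : Fin 2 → ℝ | eval v A = 0 ∧ eval v B = 0}.encard
      ≤ ((A.totalDegree * B.totalDegree : ℕ) : ℕ∞) := by
  by_contra! h
  -- A finite subset with one point too many, so that finiteness of the zero set need not be known.
  obtain ⟨t, ht, htc⟩ := Set.exists_subset_encard_eq (Order.add_one_le_of_lt h)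
  have hfin : t.Finite := Set.finite_of_encard_le_coe (k := A.totalDegree * B.totalDegree + 1)
    (by rw [htc]; norm_cast)
  have := card_le_of_forall_eval_eq_zero hA hB hAB hfin.toFinset (fun v hv => ht (by simpa using hv))
  rw [hfin.encard_eq_coe_toFinset_card] at htc
  norm_cast at htc
  omega

end

/-! ### Transversal orbits of a Lipschitz field and their persistence. -/

section

open Set

section flow

variable {E : Type*} [NormedAddCommGroup E] [NormedSpace ℝ E]

/-- `φ` solves the autonomous equation `φ' = V(φ)` on `[0, T]`. -/
def SolvesODE (V : E → E) (T : ℝ) (φ : ℝ → E) : Prop :=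
  ∀ t ∈ Icc 0 T, HasDerivWithinAt φ (V (φ t)) (Icc 0 T) t

namespace SolvesODE

variable {V : E → E} {T : ℝ} {φ ψ : ℝ → E}

theorem continuousOn (h : SolvesODE V T φ) : ContinuousOn φ (Icc 0 T) :=
  fun t ht => (h t ht).continuousWithinAt

theorem hasDerivWithinAt_Ici (h : SolvesODE V T φ) {t : ℝ} (ht : t ∈ Ico 0 T) :
    HasDerivWithinAt φ (V (φ t)) (Ici t) t :=
  (h t ⟨ht.1, ht.2.le⟩).mono_of_mem_nhdsWithin
    (Filter.mem_of_superset (Icc_mem_nhdsGE ht.2) (Icc_subset_Icc_left ht.1))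

theorem hasDerivAt (h : SolvesODE V T φ) {t : ℝ} (ht : t ∈ Ioo 0 T) :
    HasDerivAt φ (V (φ t)) t :=
  (h t ⟨ht.1.le, ht.2.le⟩).hasDerivAt (Icc_mem_nhds ht.1 ht.2)

theorem mono {T' : ℝ} (h : SolvesODE V T φ) (hT : T' ≤ T) : SolvesODE V T' φ := fun t ht =>
  (h t ⟨ht.1, ht.2.trans hT⟩).mono (Icc_subset_Icc_right hT)

theorem dist_le {K : NNReal} (hV : LipschitzWith K V) (hφ : SolvesODE V T φ)
    (hψ : SolvesODE V T ψ) {t : ℝ} (ht : t ∈ Icc 0 T) :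
    dist (φ t) (ψ t) ≤ dist (φ 0) (ψ 0) * Real.exp (K * t) := by
  simpa using dist_le_of_trajectories_ODE (v := fun _ => V) (fun _ => hV) hφ.continuousOn
    (fun t ht => hφ.hasDerivWithinAt_Ici ht) hψ.continuousOn
    (fun t ht => hψ.hasDerivWithinAt_Ici ht) le_rfl t ht

theorem eqOn {K : NNReal} (hV : LipschitzWith K V) (hφ : SolvesODE V T φ)
    (hψ : SolvesODE V T ψ) (h0 : φ 0 = ψ 0) : EqOn φ ψ (Icc 0 T) := by
  intro t ht
  have := dist_le hV hφ hψ ht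
  rw [h0, dist_self, zero_mul] at this
  exact dist_le_zero.1 this

/-- A global bound `M` confines solutions to the ball of radius `M * T`, so Picard–Lindelöf applies
on all of `[0, T]` without shrinking the interval. -/
theorem exists_of_lipschitzWith [CompleteSpace E] {K M : NNReal} (hV : LipschitzWith K V)
    (hM : ∀ x, ‖V x‖ ≤ M) (x : E) (hT : 0 ≤ T) : ∃ φ : ℝ → E, φ 0 = x ∧ SolvesODE V T φ := by
  have h : IsPicardLindelof (fun _ => V) (⟨0, le_rfl, hT⟩ : Icc (0 : ℝ) T) x (M * T.toNNReal) 0 M K :=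
    { lipschitzOnWith := fun _ _ => hV.lipschitzOnWith
      continuousOn := fun _ _ => continuousOn_const
      norm_le := fun _ _ x _ => hM x
      mul_max_le := by simp [hT] }
  exact h.exists_eq_forall_mem_Icc_hasDerivWithinAt₀

/-- The derivative of a functional along a solution. -/
theorem hasDerivWithinAt_comp (h : SolvesODE V T φ) (l : E →L[ℝ] ℝ) (p : E) {t : ℝ}
    (ht : t ∈ Icc 0 T) : HasDerivWithinAt (fun t => l (φ t - p)) (l (V (φ t))) (Icc 0 T) t :=
  l.hasFDerivAt.comp_hasDerivWithinAt t ((h t ht).sub_const p)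

theorem strictMonoOn_comp (h : SolvesODE V T φ) (l : E →L[ℝ] ℝ) (p : E) {a b : ℝ} (ha : 0 ≤ a)
    (hb : b ≤ T) (hl : ∀ t ∈ Icc a b, 0 < l (V (φ t))) :
    StrictMonoOn (fun t => l (φ t - p)) (Icc a b) := by
  have hsub : Icc a b ⊆ Icc 0 T := Icc_subset_Icc ha hb
  refine strictMonoOn_of_hasDerivWithinAt_pos (f' := fun t => l (V (φ t))) (convex_Icc a b)
    (fun t ht => ((h.hasDerivWithinAt_comp l p (hsub ht)).mono hsub).continuousWithinAt)
    (fun t ht => ?_) (fun t ht => hl t (interior_subset ht))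
  exact (h.hasDerivWithinAt_comp l p (hsub (interior_subset ht))).mono
    (interior_subset.trans hsub)

theorem nonneg_of_left {l : E →L[ℝ] ℝ} {p : E} (h : SolvesODE V T φ) (hT : 0 < T) (h0 : φ 0 = p)
    (hl : ∀ᶠ t in nhdsWithin 0 (Ioi 0), 0 < l (φ t - p)) : 0 ≤ l (V p) := by
  have hd := h.hasDerivWithinAt_comp l p (left_mem_Icc.2 hT.le)
  rw [h0] at hd
  have hm : Icc 0 T ∈ nhdsWithin 0 (Ioi 0) := Icc_mem_nhdsGT_of_mem ⟨le_rfl, hT⟩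
  have hd' := hasDerivWithinAt_iff_tendsto_slope.1 (hd.mono_of_mem_nhdsWithin hm)
  rw [sdiff_singleton_eq_self (by simp)] at hd'
  refine ge_of_tendsto hd' ?_
  filter_upwards [hl, self_mem_nhdsWithin] with t ht ht0
  rw [slope_def_field, h0]
  simp only [sub_self, map_zero, sub_zero]
  exact (div_pos ht ht0).le

theorem nonpos_of_right {l : E →L[ℝ] ℝ} {q : E} (h : SolvesODE V T φ) (hT : 0 < T) (h1 : φ T = q)
    (hl : ∀ᶠ t in nhdsWithin T (Iio T), 0 < l (φ t - q)) : l (V q) ≤ 0 := by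
  have hd := h.hasDerivWithinAt_comp l q (right_mem_Icc.2 hT.le)
  rw [h1] at hd
  have hm : Icc 0 T ∈ nhdsWithin T (Iio T) := Icc_mem_nhdsLT_of_mem ⟨hT, le_rfl⟩
  have hd' := hasDerivWithinAt_iff_tendsto_slope.1 (hd.mono_of_mem_nhdsWithin hm)
  rw [sdiff_singleton_eq_self (by simp)] at hd'
  refine le_of_tendsto hd' ?_
  filter_upwards [hl, self_mem_nhdsWithin] with t ht ht0
  rw [slope_def_field, h1]
  simp only [sub_self, map_zero, sub_zero]
  exact (div_neg_of_pos_of_neg ht (sub_neg.2 ht0)).le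

end SolvesODE

/-- Near `p`, the set `Ω` is the half space `{z | 0 < l (z - p)}`. -/
def IsLocalHalfSpace (Ω : Set E) (p : E) (l : E →L[ℝ] ℝ) : Prop :=
  ∀ᶠ z in nhds p, z ∈ Ω ↔ 0 < l (z - p)

namespace SolvesODE

variable {V : E → E} {T : ℝ} {φ : ℝ → E} {Ω : Set E} {p q : E} {lp lq : E →L[ℝ] ℝ}

theorem nonneg_of_isLocalHalfSpace (h : SolvesODE V T φ) (hT : 0 < T) (h0 : φ 0 = p)
    (hΩ : ∀ t ∈ Ioo 0 T, φ t ∈ Ω) (hp : IsLocalHalfSpace Ω p lp) : 0 ≤ lp (V p) := by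
  refine h.nonneg_of_left hT h0 ?_
  have hc : Filter.Tendsto φ (nhdsWithin 0 (Ioi 0)) (nhds p) := by
    rw [← h0]
    exact ((h.continuousOn 0 (left_mem_Icc.2 hT.le)).mono_of_mem_nhdsWithin
      (Icc_mem_nhdsGT_of_mem ⟨le_rfl, hT⟩))
  filter_upwards [hc.eventually hp, Ioo_mem_nhdsGT hT] with t h1 h2
  exact h1.1 (hΩ t h2)

theorem nonpos_of_isLocalHalfSpace (h : SolvesODE V T φ) (hT : 0 < T) (h1 : φ T = q)
    (hΩ : ∀ t ∈ Ioo 0 T, φ t ∈ Ω) (hq : IsLocalHalfSpace Ω q lq) : lq (V q) ≤ 0 := by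
  refine h.nonpos_of_right hT h1 ?_
  have hc : Filter.Tendsto φ (nhdsWithin T (Iio T)) (nhds q) := by
    rw [← h1]
    exact ((h.continuousOn T (right_mem_Icc.2 hT.le)).mono_of_mem_nhdsWithin
      (Icc_mem_nhdsLT_of_mem ⟨hT, le_rfl⟩))
  filter_upwards [hc.eventually hq, Ioo_mem_nhdsLT hT] with t h1 h2
  exact h1.1 (hΩ t h2)

/-- A solution that crosses an open set from `p` to `q`, transversally at both ends, persists when
the initial point moves along the boundary. -/
theorem exists_perturbation [CompleteSpace E] {K M : NNReal} (hV : LipschitzWith K V)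
    (hM : ∀ x, ‖V x‖ ≤ M) (hΩo : IsOpen Ω) (h : SolvesODE V T φ) (hT : 0 < T) (h0 : φ 0 = p)
    (h1 : φ T = q) (hΩ : ∀ t ∈ Ioo 0 T, φ t ∈ Ω) (hp : IsLocalHalfSpace Ω p lp)
    (hq : IsLocalHalfSpace Ω q lq) (htp : lp (V p) ≠ 0) (htq : lq (V q) ≠ 0) {ε : ℝ}
    (hε : 0 < ε) :
    ∃ δ > 0, ∀ p', dist p' p < δ → lp (p' - p) = 0 → ∃ (T' : ℝ) (ψ : ℝ → E), 0 < T' ∧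
      ψ 0 = p' ∧ SolvesODE V T' ψ ∧ (∀ t ∈ Ioo 0 T', ψ t ∈ Ω) ∧ dist (ψ T') q < ε ∧
      lq (ψ T' - q) = 0 ∧ ∀ t ∈ Icc 0 T', ∃ s ∈ Icc 0 T, dist (ψ t) (φ s) < ε := by
  have hpos : 0 < lp (V p) :=
    lt_of_le_of_ne (h.nonneg_of_isLocalHalfSpace hT h0 hΩ hp) (Ne.symm htp)
  have hneg : lq (V q) < 0 :=
    lt_of_le_of_ne (h.nonpos_of_isLocalHalfSpace hT h1 hΩ hq) htq
  -- The orbit is continued beyond its exit time, so that it visibly crosses the boundary at `q`.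
  obtain ⟨φ₀, hφ₀, hs₀⟩ := exists_of_lipschitzWith hV hM p (T := T + 1) (by linarith)
  have heq : EqOn φ₀ φ (Icc 0 T) := eqOn hV (hs₀.mono (by linarith)) h (by rw [hφ₀, h0])
  have hcV := hV.continuous
  obtain ⟨r, hr, hrp⟩ : ∃ r > 0, ∀ z, dist z p < r → (z ∈ Ω ↔ 0 < lp (z - p)) ∧ 0 < lp (V z) :=
    Metric.eventually_nhds_iff.1 (hp.and
      (((lp.continuous.comp hcV).tendsto p).eventually (lt_mem_nhds hpos)))
  obtain ⟨ρ', hρ', hρq'⟩ : ∃ r > 0, ∀ z, dist z q < r →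
      (z ∈ Ω ↔ 0 < lq (z - q)) ∧ lq (V z) < 0 :=
    Metric.eventually_nhds_iff.1 (hq.and
      (((lq.continuous.comp hcV).tendsto q).eventually (gt_mem_nhds hneg)))
  obtain ⟨ρ, hρ, hρε, hρq⟩ : ∃ r > 0, r ≤ ε ∧ ∀ z, dist z q < r →
      (z ∈ Ω ↔ 0 < lq (z - q)) ∧ lq (V z) < 0 :=
    ⟨min ρ' ε, lt_min hρ' hε, min_le_right _ _, fun z hz =>
      hρq' z (hz.trans_le (min_le_left _ _))⟩
  have hqT : φ₀ T = q := by rw [heq (right_mem_Icc.2 hT.le), h1]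
  obtain ⟨η₁, hη₁, hηp⟩ : ∃ η > 0, ∀ t ∈ Icc 0 (T + 1), dist t 0 < η → dist (φ₀ t) p < r / 2 := by
    have := Metric.continuousOn_iff.1 hs₀.continuousOn 0 ⟨le_rfl, by linarith⟩ (r / 2) (by linarith)
    rw [hφ₀] at this
    exact this
  obtain ⟨η₂, hη₂, hηq⟩ : ∃ η > 0, ∀ t ∈ Icc 0 (T + 1), dist t T < η → dist (φ₀ t) q < ρ / 2 := by
    have := Metric.continuousOn_iff.1 hs₀.continuousOn T ⟨hT.le, by linarith⟩ (ρ / 2) (by linarith)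
    rw [hqT] at this
    exact this
  -- `η` cuts the time interval into an entry phase `[0, η]`, a compact middle part inside `Ω`, and
  -- an exit phase `[T - η, T + η]`.
  obtain ⟨η, hη, hη1, hη2, hη3, hη4⟩ : ∃ η > 0, η < η₁ ∧ η < η₂ ∧ η < T ∧ η < 1 := by
    obtain ⟨η, hη, h'⟩ := exists_between (lt_min (lt_min hη₁ hη₂) (lt_min hT one_pos))
    simp only [lt_min_iff] at h'
    exact ⟨η, hη, h'.1.1, h'.1.2, h'.2.1, h'.2.2⟩
  have hnearp : ∀ t ∈ Icc 0 η, dist (φ₀ t) p < r / 2 := fun t ht =>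
    hηp t ⟨ht.1, by linarith [ht.2]⟩ (by
      rw [Real.dist_eq, abs_lt]; constructor <;> linarith [ht.1, ht.2])
  have hnearq : ∀ t ∈ Icc (T - η) (T + η), dist (φ₀ t) q < ρ / 2 := fun t ht =>
    hηq t ⟨by linarith [ht.1], by linarith [ht.2]⟩ (by
      rw [Real.dist_eq, abs_lt]; constructor <;> linarith [ht.1, ht.2])
  -- the compact middle part of the orbit
  have hKc : IsCompact (φ₀ '' Icc η (T - η)) := isCompact_Icc.image_of_continuousOn
    (hs₀.continuousOn.mono (Icc_subset_Icc hη.le (by linarith)))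
  have hKΩ : φ₀ '' Icc η (T - η) ⊆ Ω := by
    rintro _ ⟨t, ht, rfl⟩
    have h3 : 0 < t := hη.trans_le ht.1
    have h4 : t < T := by linarith [ht.2]
    rw [heq ⟨h3.le, h4.le⟩]
    exact hΩ t ⟨h3, h4⟩
  obtain ⟨κ, hκ, hκΩ⟩ := hKc.exists_thickening_subset_open hΩo hKΩ
  have hend : lq (φ₀ (T + η) - q) < 0 := by
    have := (hs₀.strictMonoOn_comp (-lq) q (a := T) (b := T + η) hT.le (by linarith)
      (fun t ht => by
        have := (hρq _ ((hnearq t ⟨by linarith [ht.1], ht.2⟩).trans (by linarith))).2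
        simpa using this)) (left_mem_Icc.2 (by linarith)) (right_mem_Icc.2 (by linarith))
        (by linarith)
    simp only [hqT] at this
    simpa using this
  have hstart : 0 < lq (φ₀ (T - η) - q) := by
    have h3 := (hρq _ ((hnearq (T - η) ⟨le_rfl, by linarith⟩).trans (by linarith))).1
    refine h3.1 ?_
    rw [heq ⟨by linarith, by linarith⟩]
    exact hΩ _ ⟨by linarith, by linarith⟩
  obtain ⟨κ₂, hκ₂, hκend⟩ : ∃ r > 0, ∀ z, dist z (φ₀ (T + η)) < r → lq (z - q) < 0 :=
    Metric.eventually_nhds_iff.1 ((Continuous.tendsto (f := fun z => lq (z - q))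
      (by fun_prop) _).eventually (gt_mem_nhds hend))
  obtain ⟨κ₃, hκ₃, hκstart⟩ : ∃ r > 0, ∀ z, dist z (φ₀ (T - η)) < r → 0 < lq (z - q) :=
    Metric.eventually_nhds_iff.1 ((Continuous.tendsto (f := fun z => lq (z - q))
      (by fun_prop) _).eventually (lt_mem_nhds hstart))
  obtain ⟨σ, hσ, hσκ, hσκ₂, hσκ₃, hσr, hσρ⟩ :
      ∃ σ > 0, σ < κ ∧ σ < κ₂ ∧ σ < κ₃ ∧ σ < r / 2 ∧ σ < ρ / 2 := by
    obtain ⟨σ, hσ, h'⟩ := exists_between (lt_min (lt_min (lt_min hκ hκ₂) hκ₃)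
      (lt_min (half_pos hr) (half_pos hρ)))
    simp only [lt_min_iff] at h'
    exact ⟨σ, hσ, h'.1.1.1, h'.1.1.2, h'.1.2, h'.2.1, h'.2.2⟩
  -- The factor offsets the Grönwall growth, keeping the two orbits within `σ` up to time `T + 1`.
  refine ⟨σ * Real.exp (-(K * (T + 1))), by positivity, fun p' hp' hlp' => ?_⟩
  obtain ⟨ψ, hψ0, hsψ⟩ := exists_of_lipschitzWith hV hM p' (T := T + 1) (by linarith)
  have hclose : ∀ t ∈ Icc 0 (T + 1), dist (ψ t) (φ₀ t) < σ := by
    intro t ht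
    refine (dist_le hV hsψ hs₀ ht).trans_lt ?_
    rw [hψ0, hφ₀]
    calc dist p' p * Real.exp (K * t) ≤ dist p' p * Real.exp (K * (T + 1)) := by
          gcongr
          exact ht.2
      _ < σ * Real.exp (-(K * (T + 1))) * Real.exp (K * (T + 1)) := by gcongr
      _ = σ := by rw [mul_assoc, ← Real.exp_add]; simp
  have hψp : ∀ t ∈ Icc 0 η, dist (ψ t) p < r := fun t ht => by
    have := dist_triangle (ψ t) (φ₀ t) p
    have := hclose t ⟨ht.1, by linarith [ht.2]⟩
    linarith [hnearp t ht]
  have hψq : ∀ t ∈ Icc (T - η) (T + η), dist (ψ t) q < ρ := fun t ht => by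
    have := dist_triangle (ψ t) (φ₀ t) q
    have := hclose t ⟨by linarith [ht.1], by linarith [ht.2]⟩
    linarith [hnearq t ht]
  have hgc : ContinuousOn (fun t => lq (ψ t - q)) (Icc (T - η) (T + η)) := by
    have hsub : Icc (T - η) (T + η) ⊆ Icc 0 (T + 1) := Icc_subset_Icc (by linarith) (by linarith)
    have := hsψ.continuousOn.mono hsub
    fun_prop
  have hg1 : 0 < lq (ψ (T - η) - q) :=
    hκstart _ ((hclose _ ⟨by linarith, by linarith⟩).trans hσκ₃)
  have hg2 : lq (ψ (T + η) - q) < 0 :=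
    hκend _ ((hclose _ ⟨by linarith, by linarith⟩).trans hσκ₂)
  obtain ⟨T', ⟨hT'1, hT'2⟩, hT'0⟩ : (0 : ℝ) ∈ (fun t => lq (ψ t - q)) '' Ioo (T - η) (T + η) :=
    intermediate_value_Ioo' (by linarith) hgc ⟨hg2, hg1⟩
  have hT'pos : 0 < T' := by linarith
  refine ⟨T', ψ, hT'pos, hψ0, hsψ.mono (by linarith), ?_,
    (hψq T' ⟨hT'1.le, hT'2.le⟩).trans_le hρε, hT'0, ?_⟩
  -- On entry `lp` increases from `0`; in the middle the orbit stays in a thickening of a compact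
  -- subset of `Ω`; on exit `lq` decreases to its zero at `T'`.
  · intro t ht
    rcases le_or_gt t η with h3 | h3
    · refine (hrp _ (hψp t ⟨ht.1.le, h3⟩)).1.2 ?_
      have := (hsψ.strictMonoOn_comp lp p (a := 0) (b := η) le_rfl (by linarith)
        (fun t ht => (hrp _ (hψp t ht)).2)) (left_mem_Icc.2 hη.le) ⟨ht.1.le, h3⟩ ht.1
      simpa [hψ0, hlp'] using this
    rcases le_or_gt t (T - η) with h4 | h4
    · refine hκΩ (Metric.mem_thickening_iff.2 ⟨φ₀ t, ⟨t, ⟨h3.le, h4⟩, rfl⟩, ?_⟩)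
      exact (hclose t ⟨by linarith, by linarith⟩).trans hσκ
    · refine (hρq _ (hψq t ⟨h4.le, by linarith [ht.2]⟩)).1.2 ?_
      have := (hsψ.strictMonoOn_comp (-lq) q (a := T - η) (b := T + η) (by linarith) (by linarith)
        (fun t ht => by simpa using (hρq _ (hψq t ht)).2)) (a := t) (b := T')
        ⟨h4.le, by linarith [ht.2]⟩ ⟨hT'1.le, hT'2.le⟩ ht.2
      simp only [neg_apply, neg_lt_neg_iff] at this
      rw [← hT'0]
      exact this
  · intro t ht
    rcases le_or_gt t T with h3 | h3
    · refine ⟨t, ⟨ht.1, h3⟩, ?_⟩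
      rw [← heq ⟨ht.1, h3⟩]
      exact (hclose t ⟨ht.1, by linarith⟩).trans (by linarith)
    · refine ⟨T, right_mem_Icc.2 hT.le, ?_⟩
      rw [h1]
      exact (hψq t ⟨by linarith, by linarith [ht.2]⟩).trans_le hρε

end SolvesODE

end flow

end

/-! ### Arcs of the Hamiltonian field in the unit square. -/

section

open Set

namespace TorusPSVF

variable {H : MvPolynomial (Fin 2) ℝ}

theorem hasStrictFDerivAt_value (H : MvPolynomial (Fin 2) ℝ) (p : ℝ × ℝ) :
    HasStrictFDerivAt (value H) ((grad H p).1 • ContinuousLinearMap.fst ℝ ℝ ℝ +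
      (grad H p).2 • ContinuousLinearMap.snd ℝ ℝ ℝ) p := by
  induction H using MvPolynomial.induction_on with
  | C a =>
    have : value (MvPolynomial.C a) = fun _ => a := by ext; simp [value]
    rw [this]
    simpa [grad, value] using hasStrictFDerivAt_const a p
  | add f g hf hg =>
    have : value (f + g) = fun z => value f z + value g z := by ext; simp [value]
    rw [this]
    refine (hf.add hg).congr_fderiv ?_
    ext <;> simp [grad, value]
  | mul_X f i hf =>
    have hX : HasStrictFDerivAt (fun z : ℝ × ℝ => (![z.1, z.2] : Fin 2 → ℝ) i)
        ((![ContinuousLinearMap.fst ℝ ℝ ℝ, ContinuousLinearMap.snd ℝ ℝ ℝ] :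
          Fin 2 → (ℝ × ℝ →L[ℝ] ℝ)) i) p := by
      fin_cases i
      · exact hasStrictFDerivAt_fst
      · exact hasStrictFDerivAt_snd
    have : value (f * MvPolynomial.X i) =
        fun z => value f z * (![z.1, z.2] : Fin 2 → ℝ) i := by ext; simp [value]
    rw [this]
    refine (hf.mul hX).congr_fderiv ?_
    fin_cases i <;> ext <;> simp [grad, value, MvPolynomial.pderiv_X]

theorem continuous_value (H : MvPolynomial (Fin 2) ℝ) : Continuous (value H) :=
  continuous_iff_continuousAt.2 fun p => (hasStrictFDerivAt_value H p).continuousAt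

theorem locallyLipschitz_X (H : MvPolynomial (Fin 2) ℝ) : LocallyLipschitz (X H) := by
  intro p
  have h : HasStrictFDerivAt (X H) _ p :=
    (hasStrictFDerivAt_value (MvPolynomial.pderiv 1 H) p).neg.prodMk
      (hasStrictFDerivAt_value (MvPolynomial.pderiv 0 H) p)
  exact h.exists_lipschitzOnWith

/-- `X_H` on the closed unit square extends to a bounded Lipschitz field on the plane. -/
theorem exists_lipschitz_extension (H : MvPolynomial (Fin 2) ℝ) :
    ∃ (V : ℝ × ℝ → ℝ × ℝ) (K M : NNReal), LipschitzWith K V ∧ (∀ z, ‖V z‖ ≤ M) ∧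
      ∀ z ∈ Icc (0 : ℝ × ℝ) 1, V z = X H z := by
  obtain ⟨K, hK⟩ := ((locallyLipschitz_X H).locallyLipschitzOn
    (s := Icc (0 : ℝ × ℝ) 1)).exists_lipschitzOnWith_of_compact isCompact_Icc
  let c : ℝ × ℝ → ℝ × ℝ := fun z => ((projIcc (0 : ℝ) 1 zero_le_one z.1 : ℝ),
    (projIcc (0 : ℝ) 1 zero_le_one z.2 : ℝ))
  have hc : ∀ z, c z ∈ Icc (0 : ℝ × ℝ) 1 := fun z =>
    ⟨⟨(projIcc (0 : ℝ) 1 zero_le_one z.1).2.1, (projIcc (0 : ℝ) 1 zero_le_one z.2).2.1⟩,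
      ⟨(projIcc (0 : ℝ) 1 zero_le_one z.1).2.2, (projIcc (0 : ℝ) 1 zero_le_one z.2).2.2⟩⟩
  have hp : LipschitzWith 1 fun t : ℝ => (projIcc (0 : ℝ) 1 zero_le_one t : ℝ) :=
    (LipschitzWith.projIcc zero_le_one)
  have hcl : LipschitzWith 1 c := by
    simpa using (hp.comp LipschitzWith.prod_fst).prodMk (hp.comp LipschitzWith.prod_snd)
  obtain ⟨M, hM⟩ := isCompact_Icc.exists_bound_of_continuousOn
    (locallyLipschitz_X H).continuous.continuousOn (s := Icc (0 : ℝ × ℝ) 1)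
  refine ⟨X H ∘ c, K * 1, M.toNNReal, ?_, fun z => (hM _ (hc z)).trans (Real.le_coe_toNNReal M),
    fun z hz => ?_⟩
  · rw [← lipschitzOnWith_univ]
    exact hK.comp hcl.lipschitzOnWith (fun z _ => hc z)
  · have : c z = z := by
      ext
      · simp [c, projIcc_of_mem zero_le_one (⟨hz.1.1, hz.2.1⟩ : z.1 ∈ Icc (0 : ℝ) 1)]
      · simp [c, projIcc_of_mem zero_le_one (⟨hz.1.2, hz.2.2⟩ : z.2 ∈ Icc (0 : ℝ) 1)]
    simp [this]

theorem openSquare_subset_Icc : openSquare ⊆ Icc (0 : ℝ × ℝ) 1 := fun _ hz =>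
  ⟨⟨hz.1.1.le, hz.2.1.le⟩, ⟨hz.1.2.le, hz.2.2.le⟩⟩

theorem edges_subset_Icc : edges ⊆ Icc (0 : ℝ × ℝ) 1 := by
  rintro ⟨a, b⟩ (⟨h | h, h1, h2⟩ | ⟨⟨h1, h2⟩, h | h⟩) <;> simp only at h h1 h2 <;> subst h <;>
    exact ⟨⟨by simp [h1.le], by simp [h1.le]⟩, ⟨by simp [h2.le], by simp [h2.le]⟩⟩

theorem disjoint_edges_openSquare : Disjoint edges openSquare := by
  rw [Set.disjoint_left]
  rintro ⟨a, b⟩ (⟨h | h, -⟩ | ⟨-, h | h⟩) ⟨⟨h1, h2⟩, h3, h4⟩ <;> simp only at h h1 h2 h3 h4 <;>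
    linarith

theorem inwardNormal_zero_left (y : ℝ) : inwardNormal (0, y) = (1, 0) := by
  simp [inwardNormal]

theorem inwardNormal_one_left (y : ℝ) : inwardNormal (1, y) = (-1, 0) := by
  simp [inwardNormal]

theorem inwardNormal_zero_right {x : ℝ} (hx : x ∈ Ioo (0 : ℝ) 1) :
    inwardNormal (x, 0) = (0, 1) := by
  simp [inwardNormal, hx.1.ne', hx.2.ne]

theorem inwardNormal_one_right {x : ℝ} (hx : x ∈ Ioo (0 : ℝ) 1) :
    inwardNormal (x, 1) = (0, -1) := by
  simp [inwardNormal, hx.1.ne', hx.2.ne]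

/-- The component along the inward normal at `p`, as a functional. -/
noncomputable def normalComponent (p : ℝ × ℝ) : ℝ × ℝ →L[ℝ] ℝ :=
  (inwardNormal p).1 • ContinuousLinearMap.fst ℝ ℝ ℝ +
    (inwardNormal p).2 • ContinuousLinearMap.snd ℝ ℝ ℝ

theorem normalComponent_apply (p v : ℝ × ℝ) :
    normalComponent p v = dot v (inwardNormal p) := by
  simp [normalComponent, dot, mul_comm]

theorem isLocalHalfSpace_openSquare {p : ℝ × ℝ} (hp : p ∈ edges) :
    IsLocalHalfSpace openSquare p (normalComponent p) := by
  have hfst := continuous_fst.tendsto p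
  have hsnd := continuous_snd.tendsto p
  obtain ⟨a, b⟩ := p
  unfold IsLocalHalfSpace
  rcases hp with ⟨h | h, hb⟩ | ⟨ha, h | h⟩ <;> simp only at h <;> subst h
  · simp only [normalComponent_apply, inwardNormal_zero_left]
    filter_upwards [hfst.eventually (gt_mem_nhds (show (0 : ℝ) < 1 by norm_num)),
      hsnd.eventually (Ioo_mem_nhds hb.1 hb.2)] with z h1 h2
    simp [openSquare, dot, h1, h2.1, h2.2]
  · simp only [normalComponent_apply, inwardNormal_one_left]
    filter_upwards [hfst.eventually (lt_mem_nhds (show (0 : ℝ) < 1 by norm_num)),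
      hsnd.eventually (Ioo_mem_nhds hb.1 hb.2)] with z h1 h2
    simp [openSquare, dot, h1, h2.1, h2.2]
  · simp only [normalComponent_apply, inwardNormal_zero_right ha]
    filter_upwards [hsnd.eventually (gt_mem_nhds (show (0 : ℝ) < 1 by norm_num)),
      hfst.eventually (Ioo_mem_nhds ha.1 ha.2)] with z h1 h2
    simp [openSquare, dot, h1, h2.1, h2.2]
  · simp only [normalComponent_apply, inwardNormal_one_right ha]
    filter_upwards [hsnd.eventually (lt_mem_nhds (show (0 : ℝ) < 1 by norm_num)),
      hfst.eventually (Ioo_mem_nhds ha.1 ha.2)] with z h1 h2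
    simp [openSquare, dot, h1, h2.1, h2.2]

theorem eventually_mem_edges {p : ℝ × ℝ} (hp : p ∈ edges) :
    ∀ᶠ z in nhds p, normalComponent p (z - p) = 0 → z ∈ edges := by
  have hfst := continuous_fst.tendsto p
  have hsnd := continuous_snd.tendsto p
  obtain ⟨a, b⟩ := p
  rcases hp with ⟨h | h, hb⟩ | ⟨ha, h | h⟩ <;> simp only at h <;> subst h
  · filter_upwards [hsnd.eventually (Ioo_mem_nhds hb.1 hb.2)] with z h2 h
    rw [normalComponent_apply, inwardNormal_zero_left] at h
    exact Or.inl ⟨Or.inl (by simpa [dot] using h), h2⟩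
  · filter_upwards [hsnd.eventually (Ioo_mem_nhds hb.1 hb.2)] with z h2 h
    rw [normalComponent_apply, inwardNormal_one_left] at h
    exact Or.inl ⟨Or.inr (by simp [dot] at h; linarith), h2⟩
  · filter_upwards [hfst.eventually (Ioo_mem_nhds ha.1 ha.2)] with z h2 h
    rw [normalComponent_apply, inwardNormal_zero_right ha] at h
    exact Or.inr ⟨h2, Or.inl (by simpa [dot] using h)⟩
  · filter_upwards [hfst.eventually (Ioo_mem_nhds ha.1 ha.2)] with z h2 h
    rw [normalComponent_apply, inwardNormal_one_right ha] at h
    exact Or.inr ⟨h2, Or.inr (by simp [dot] at h; linarith)⟩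

/-- `X_H` is the gradient turned by a right angle, so the derivative of `H` along an edge is, up to
sign, the normal component of `X_H`. -/
theorem norm_fderiv_of_tangent {q d : ℝ × ℝ} (hq : q ∈ edges) (hd : normalComponent q d = 0) :
    |(grad H q).1 * d.1 + (grad H q).2 * d.2| = |dot (X H q) (inwardNormal q)| * ‖d‖ := by
  rw [normalComponent_apply] at hd
  rw [Prod.norm_def]
  obtain ⟨a, b⟩ := q
  rcases hq with ⟨h | h, hb⟩ | ⟨ha, h | h⟩ <;> simp only at h <;> subst h
  · rw [inwardNormal_zero_left] at hd ⊢
    have : d.1 = 0 := by simpa [dot] using hd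
    simp [this, dot, X, abs_mul]
  · rw [inwardNormal_one_left] at hd ⊢
    have : d.1 = 0 := by simpa [dot] using hd
    simp [this, dot, X, abs_mul]
  · rw [inwardNormal_zero_right ha] at hd ⊢
    have : d.2 = 0 := by simpa [dot] using hd
    simp [this, dot, X, abs_mul]
  · rw [inwardNormal_one_right ha] at hd ⊢
    have : d.2 = 0 := by simpa [dot] using hd
    simp [this, dot, X, abs_mul]

/-- If the field is transversal to the boundary at `q`, the Hamiltonian is injective on the boundary
near `q`. -/
theorem exists_injOn_edge {q : ℝ × ℝ} (hq : q ∈ edges)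
    (ht : dot (X H q) (inwardNormal q) ≠ 0) :
    ∃ ρ > 0, ∀ z w : ℝ × ℝ, dist z q < ρ → dist w q < ρ → normalComponent q (z - q) = 0 →
      normalComponent q (w - q) = 0 → value H z = value H w → z = w := by
  -- An error of half the tangential derivative cannot cancel it in the strict differentiability
  -- estimate.
  have hc : 0 < |dot (X H q) (inwardNormal q)| / 2 := by positivity
  have h := (hasStrictFDerivAt_value H q).isLittleO.def hc
  rw [nhds_prod_eq, Filter.eventually_iff] at h
  obtain ⟨ρ, hρ, hsub⟩ := (Metric.nhds_basis_ball.prod_self).mem_iff.1 h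
  refine ⟨ρ, hρ, fun z w hz hw hzq hwq hv => ?_⟩
  have h1 := hsub (show (z, w) ∈ Metric.ball q ρ ×ˢ Metric.ball q ρ from ⟨hz, hw⟩)
  have hd : normalComponent q (z - w) = 0 := by
    rw [← sub_sub_sub_cancel_right z w q, map_sub, hzq, hwq, sub_zero]
  have h2 := norm_fderiv_of_tangent (H := H) hq hd
  simp only [mem_ofPred_eq, hv, sub_self, zero_sub, Real.norm_eq_abs, abs_neg,
    add_apply, smul_apply, ContinuousLinearMap.coe_fst',
    ContinuousLinearMap.coe_snd', smul_eq_mul] at h1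
  rw [h2] at h1
  by_contra hne
  have : 0 < ‖z - w‖ := norm_pos_iff.2 (sub_ne_zero.2 hne)
  nlinarith

theorem IsArc.exists_solvesODE {p q : ℝ × ℝ} {S : Set (ℝ × ℝ)} (h : IsArc H p q S)
    {V : ℝ × ℝ → ℝ × ℝ} (hV : ∀ z ∈ Icc (0 : ℝ × ℝ) 1, V z = X H z) :
    ∃ (T : ℝ) (φ : ℝ → ℝ × ℝ), 0 < T ∧ φ 0 = p ∧ φ T = q ∧ SolvesODE V T φ ∧
      (∀ t ∈ Ioo 0 T, φ t ∈ openSquare) ∧ S = φ '' Icc 0 T := by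
  obtain ⟨hp, hq, T, φ, hT, h0, h1, hd, hΩ, hS⟩ := h
  refine ⟨T, φ, hT, h0, h1, fun t ht => ?_, hΩ, hS⟩
  rw [hV]
  · exact hd t ht
  · rcases ht.1.eq_or_lt with rfl | h3
    · exact h0 ▸ edges_subset_Icc hp
    rcases ht.2.eq_or_lt with rfl | h4
    · exact h1 ▸ edges_subset_Icc hq
    exact openSquare_subset_Icc (hΩ t ⟨h3, h4⟩)

theorem isArc_of_solvesODE {p q : ℝ × ℝ} (hp : p ∈ edges) (hq : q ∈ edges)
    {V : ℝ × ℝ → ℝ × ℝ} (hV : ∀ z ∈ Icc (0 : ℝ × ℝ) 1, V z = X H z) {T : ℝ} {φ : ℝ → ℝ × ℝ}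
    (hT : 0 < T) (h0 : φ 0 = p) (h1 : φ T = q) (hφ : SolvesODE V T φ)
    (hΩ : ∀ t ∈ Ioo 0 T, φ t ∈ openSquare) : IsArc H p q (φ '' Icc 0 T) := by
  refine ⟨hp, hq, T, φ, hT, h0, h1, fun t ht => ?_, hΩ, rfl⟩
  rw [← hV]
  · exact hφ t ht
  · rcases ht.1.eq_or_lt with rfl | h3
    · exact h0 ▸ edges_subset_Icc hp
    rcases ht.2.eq_or_lt with rfl | h4
    · exact h1 ▸ edges_subset_Icc hq
    exact openSquare_subset_Icc (hΩ t ⟨h3, h4⟩)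

variable {p q : ℝ × ℝ} {S : Set (ℝ × ℝ)}

theorem IsArc.left_mem (h : IsArc H p q S) : p ∈ S := by
  obtain ⟨-, -, T, φ, hT, h0, -, -, -, rfl⟩ := h
  exact ⟨0, left_mem_Icc.2 hT.le, h0⟩

theorem IsArc.right_mem (h : IsArc H p q S) : q ∈ S := by
  obtain ⟨-, -, T, φ, hT, -, h1, -, -, rfl⟩ := h
  exact ⟨T, right_mem_Icc.2 hT.le, h1⟩

theorem IsArc.isCompact (h : IsArc H p q S) : IsCompact S := by
  obtain ⟨-, -, T, φ, hT, -, -, hd, -, rfl⟩ := h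
  exact isCompact_Icc.image_of_continuousOn fun t ht => (hd t ht).continuousWithinAt

theorem IsArc.eq_or_mem (h : IsArc H p q S) {z : ℝ × ℝ} (hz : z ∈ S) :
    z = p ∨ z = q ∨ z ∈ openSquare := by
  obtain ⟨-, -, T, φ, hT, h0, h1, -, hΩ, rfl⟩ := h
  obtain ⟨t, ht, rfl⟩ := hz
  rcases ht.1.eq_or_lt with rfl | h3
  · exact Or.inl h0
  rcases ht.2.eq_or_lt with rfl | h4
  · exact Or.inr (Or.inl h1)
  exact Or.inr (Or.inr (hΩ t ⟨h3, h4⟩))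

/-- Both solutions agree as long as both last; if one lasted longer, it would be on an edge at a
time when it must be in the open square. -/
theorem IsArc.unique {q' : ℝ × ℝ} {S' : Set (ℝ × ℝ)} (h : IsArc H p q S)
    (h' : IsArc H p q' S') : S = S' := by
  obtain ⟨V, K, M, hV, hM, hVX⟩ := exists_lipschitz_extension H
  obtain ⟨T, φ, hT, h0, h1, hφ, hΩ, rfl⟩ := h.exists_solvesODE hVX
  obtain ⟨T', φ', hT', h0', h1', hφ', hΩ', rfl⟩ := h'.exists_solvesODE hVX
  have key : ∀ {T T' : ℝ} {φ φ' : ℝ → ℝ × ℝ} {q : ℝ × ℝ}, 0 < T → q ∈ edges → φ 0 = p →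
      φ' 0 = p → φ T = q → SolvesODE V T φ → SolvesODE V T' φ' →
      (∀ t ∈ Ioo 0 T', φ' t ∈ openSquare) → T' ≤ T := by
    intro T T' φ φ' q hT hq h0 h0' h1 hφ hφ' hΩ'
    by_contra! hlt
    have := hφ.eqOn hV (hφ'.mono hlt.le) (h0.trans h0'.symm) (right_mem_Icc.2 hT.le)
    refine disjoint_left.1 disjoint_edges_openSquare hq ?_
    rw [← h1, this]
    exact hΩ' T ⟨hT, hlt⟩
  have hTT : T = T' := le_antisymm (key hT' h'.2.1 h0' h0 h1' hφ' hφ hΩ)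
    (key hT h.2.1 h0 h0' h1 hφ hφ' hΩ')
  subst hTT
  exact (hφ.eqOn hV hφ' (h0.trans h0'.symm)).image_eq

theorem IsArc.dot_start_nonneg (h : IsArc H p q S) : 0 ≤ dot (X H p) (inwardNormal p) := by
  obtain ⟨hp, -, T, φ, hT, h0, h1, hφ, hΩ, -⟩ := h
  rw [← normalComponent_apply]
  exact SolvesODE.nonneg_of_isLocalHalfSpace hφ hT h0 hΩ (isLocalHalfSpace_openSquare hp)

theorem IsArc.dot_end_nonpos (h : IsArc H p q S) : dot (X H q) (inwardNormal q) ≤ 0 := by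
  obtain ⟨-, hq, T, φ, hT, h0, h1, hφ, hΩ, -⟩ := h
  rw [← normalComponent_apply]
  exact SolvesODE.nonpos_of_isLocalHalfSpace hφ hT h1 hΩ (isLocalHalfSpace_openSquare hq)

theorem IsArc.value_eq (h : IsArc H p q S) : value H p = value H q := by
  obtain ⟨-, -, T, φ, hT, rfl, rfl, hφ, -, -⟩ := h
  have hφ' : SolvesODE (X H) T φ := hφ
  refine (constant_of_has_deriv_right_zero (f := fun t => value H (φ t))
    ((continuous_value H).comp_continuousOn hφ'.continuousOn) (fun t ht => ?_) T
    (right_mem_Icc.2 hT.le)).symm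
  refine ((hasStrictFDerivAt_value H (φ t)).hasFDerivAt.comp_hasDerivWithinAt t
    (hφ'.hasDerivWithinAt_Ici ht)).congr_deriv ?_
  simp [X]
  ring

/-- The flow does not let the end point be prescribed, but conservation of `H` does: the actual exit
point and `q'` lie on the same edge near `q` with equal values of `H`, where `H` is injective. -/
theorem IsArc.exists_perturbation (h : IsArc H p q S)
    (htp : dot (X H p) (inwardNormal p) ≠ 0) (htq : dot (X H q) (inwardNormal q) ≠ 0)
    {ε : ℝ} (hε : 0 < ε) :
    ∃ δ > 0, ∀ p' q', dist p' p < δ → dist q' q < δ → normalComponent p (p' - p) = 0 →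
      normalComponent q (q' - q) = 0 → value H p' = value H q' →
      ∃ S', IsArc H p' q' S' ∧ S' ⊆ Metric.thickening ε S := by
  obtain ⟨V, K, M, hV, hM, hVX⟩ := exists_lipschitz_extension H
  obtain ⟨T, φ, hT, h0, h1, hφ, hΩ, rfl⟩ := h.exists_solvesODE hVX
  obtain ⟨r, hr, hrp⟩ := Metric.eventually_nhds_iff.1 (eventually_mem_edges h.1)
  obtain ⟨ρ, hρ, hρq⟩ := Metric.eventually_nhds_iff.1 (eventually_mem_edges h.2.1)
  obtain ⟨κ, hκ, hinj⟩ := exists_injOn_edge h.2.1 htq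
  have hmin : 0 < min ε (min ρ κ) := by positivity
  obtain ⟨δ, hδ, hpert⟩ := hφ.exists_perturbation hV hM (isOpen_Ioo.prod isOpen_Ioo) hT h0 h1 hΩ
    (isLocalHalfSpace_openSquare h.1) (isLocalHalfSpace_openSquare h.2.1)
    (by rwa [hVX _ (edges_subset_Icc h.1), normalComponent_apply])
    (by rwa [hVX _ (edges_subset_Icc h.2.1), normalComponent_apply]) hmin
  refine ⟨min δ (min r κ), by positivity, fun p' q' hp' hq' hlp hlq hval => ?_⟩
  simp only [lt_min_iff] at hp' hq'
  obtain ⟨T', ψ, hT', hψ0, hψ, hψΩ, hend, hlend, hnear⟩ := hpert p' hp'.1 hlp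
  simp only [lt_min_iff] at hend hnear
  have harc := isArc_of_solvesODE (hrp hp'.2.1 hlp) (hρq hend.2.1 hlend) hVX hT' hψ0 rfl hψ hψΩ
  have hq'' : ψ T' = q' := hinj _ _ hend.2.2 hq'.2.2 hlend hlq (harc.value_eq.symm.trans hval)
  rw [hq''] at harc
  refine ⟨_, harc, ?_⟩
  rintro _ ⟨t, ht, rfl⟩
  obtain ⟨s, hs, hd⟩ := hnear t ht
  exact Metric.mem_thickening_iff.2 ⟨φ s, ⟨s, hs, rfl⟩, hd.1⟩

end TorusPSVF

end

/-! ### Cycles of type aba: uniqueness, persistence, isolation. -/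

section

open Set

namespace TorusPSVF

variable {H : MvPolynomial (Fin 2) ℝ}

theorem continuous_toTorus : Continuous toTorus :=
  ((AddCircle.continuous_mk' 1).comp continuous_fst).prodMk
    ((AddCircle.continuous_mk' 1).comp continuous_snd)

theorem eq_of_coe_unitAddCircle_eq {a b : ℝ} (ha : a ∈ Ioo (0 : ℝ) 1) (hb : b ∈ Icc (0 : ℝ) 1)
    (h : (a : UnitAddCircle) = b) : a = b := by
  obtain ⟨n, hn⟩ := (AddCircle.coe_eq_zero_iff 1).1
    (show ((a - b : ℝ) : UnitAddCircle) = 0 by rw [AddCircle.coe_sub, h, sub_self])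
  simp only [zsmul_eq_mul, mul_one] at hn
  have h1 : (n : ℝ) < 1 := by linarith [ha.2, hb.1]
  have h2 : (-1 : ℝ) < n := by linarith [ha.1, hb.2]
  have h3 : n < 1 := by exact_mod_cast h1
  have h4 : -1 < n := by exact_mod_cast h2
  have : n = 0 := by omega
  subst this
  simp at hn
  linarith

theorem sewn_horizontal_iff {x : ℝ} : Sewn H (x, 1) (x, 0) ↔
    x ∈ Ioo (0 : ℝ) 1 ∧ 0 < (grad H (x, 1)).1 * (grad H (x, 0)).1 := by
  constructor
  · rintro ⟨hp, -, -, -, h⟩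
    have hx : x ∈ Ioo (0 : ℝ) 1 := by simpa [edges] using hp
    refine ⟨hx, ?_⟩
    rw [inwardNormal_one_right hx] at h
    simpa [dot, X] using h
  · rintro ⟨hx, h⟩
    refine ⟨Or.inr ⟨hx, Or.inr rfl⟩, Or.inr ⟨hx, Or.inl rfl⟩, by simp, ?_, ?_⟩
    · simp [toTorus]
    · rw [inwardNormal_one_right hx]
      simpa [dot, X] using h

theorem sewn_horizontal_symm {x : ℝ} (h : Sewn H (x, 1) (x, 0)) : Sewn H (x, 0) (x, 1) := by
  have hx := (sewn_horizontal_iff.1 h).1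
  refine ⟨h.2.1, h.1, h.2.2.1.symm, h.2.2.2.1.symm, ?_⟩
  have := (sewn_horizontal_iff.1 h).2
  rw [inwardNormal_zero_right hx]
  simpa [dot, X, mul_comm] using this

theorem sewn_vertical_iff {y : ℝ} : Sewn H (1, y) (0, y) ↔
    y ∈ Ioo (0 : ℝ) 1 ∧ 0 < (grad H (1, y)).2 * (grad H (0, y)).2 := by
  constructor
  · rintro ⟨hp, -, -, -, h⟩
    have hx : y ∈ Ioo (0 : ℝ) 1 := by simpa [edges] using hp
    refine ⟨hx, ?_⟩
    rw [inwardNormal_one_left] at h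
    simpa [dot, X] using h
  · rintro ⟨hx, h⟩
    refine ⟨Or.inl ⟨Or.inr rfl, hx⟩, Or.inl ⟨Or.inl rfl, hx⟩, by simp, ?_, ?_⟩
    · simp [toTorus]
    · rw [inwardNormal_one_left]
      simpa [dot, X] using h

theorem sewn_vertical_symm {y : ℝ} (h : Sewn H (1, y) (0, y)) : Sewn H (0, y) (1, y) := by
  refine ⟨h.2.1, h.1, h.2.2.1.symm, h.2.2.2.1.symm, ?_⟩
  have := (sewn_vertical_iff.1 h).2
  rw [inwardNormal_zero_left]
  simpa [dot, X, mul_comm] using this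

theorem IsABACycle.isCrossingClosedOrbit {x y : ℝ} {S : Set (ℝ × ℝ)} (h : IsABACycle H x y S) :
    IsCrossingClosedOrbit H (toTorus '' S) := by
  obtain ⟨h1, h2, S₁, S₂, rfl, ⟨hS1, hS2⟩ | ⟨hS1, hS2⟩⟩ := h
  -- The index `1` stands for two arcs.
  · refine ⟨1, ![(0, y), (x, 0)], ![(x, 1), (1, y)], ![S₁, S₂], ?_, ?_, ?_⟩
    · intro i; fin_cases i <;> assumption
    · intro i; fin_cases i <;> assumption
    · congr 1; ext z; simp [Fin.exists_fin_two]
  · refine ⟨1, ![(x, 1), (1, y)], ![(0, y), (x, 0)], ![S₁, S₂], ?_, ?_, ?_⟩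
    · intro i; fin_cases i <;> assumption
    · intro i
      fin_cases i
      · exact sewn_vertical_symm h2
      · exact sewn_horizontal_symm h1
    · congr 1; ext z; simp [Fin.exists_fin_two]

theorem IsABACycle.mem_cases {x y : ℝ} {S : Set (ℝ × ℝ)} (h : IsABACycle H x y S) {z : ℝ × ℝ}
    (hz : z ∈ S) : z = (0, y) ∨ z = (x, 1) ∨ z = (x, 0) ∨ z = (1, y) ∨ z ∈ openSquare := by
  obtain ⟨h1, h2, S₁, S₂, rfl, ⟨hS1, hS2⟩ | ⟨hS1, hS2⟩⟩ := h <;> rcases hz with hz | hz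
  · have := hS1.eq_or_mem hz; tauto
  · have := hS2.eq_or_mem hz; tauto
  · have := hS1.eq_or_mem hz; tauto
  · have := hS2.eq_or_mem hz; tauto

theorem IsABACycle.mem_left {x y : ℝ} {S : Set (ℝ × ℝ)} (h : IsABACycle H x y S) :
    (0, y) ∈ S ∧ (x, 1) ∈ S := by
  obtain ⟨h1, h2, S₁, S₂, rfl, ⟨hS1, hS2⟩ | ⟨hS1, hS2⟩⟩ := h
  · exact ⟨Or.inl hS1.left_mem, Or.inl hS1.right_mem⟩
  · exact ⟨Or.inl hS1.right_mem, Or.inl hS1.left_mem⟩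

theorem IsABACycle.value_eq {x y : ℝ} {S : Set (ℝ × ℝ)} (h : IsABACycle H x y S) :
    value H (0, y) = value H (x, 1) ∧ value H (x, 0) = value H (1, y) := by
  obtain ⟨h1, h2, S₁, S₂, rfl, ⟨hS1, hS2⟩ | ⟨hS1, hS2⟩⟩ := h
  · exact ⟨hS1.value_eq, hS2.value_eq⟩
  · exact ⟨hS1.value_eq.symm, hS2.value_eq.symm⟩

theorem IsABACycle.isCompact {x y : ℝ} {S : Set (ℝ × ℝ)} (h : IsABACycle H x y S) :
    IsCompact S := by
  obtain ⟨h1, h2, S₁, S₂, rfl, ⟨hS1, hS2⟩ | ⟨hS1, hS2⟩⟩ := h <;>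
    exact hS1.isCompact.union hS2.isCompact

/-- The transition points are determined by the trace on the torus. -/
theorem IsABACycle.transition_eq {x y x' y' : ℝ} {S S' : Set (ℝ × ℝ)} (h : IsABACycle H x y S)
    (h' : IsABACycle H x' y' S') (heq : toTorus '' S' = toTorus '' S) : x' = x ∧ y' = y := by
  have hx := (sewn_horizontal_iff.1 h.1).1
  have hy := (sewn_vertical_iff.1 h.2.1).1
  have hx' := (sewn_horizontal_iff.1 h'.1).1
  have hy' := (sewn_vertical_iff.1 h'.2.1).1
  constructor
  · obtain ⟨z, hz, he⟩ : toTorus (x', 1) ∈ toTorus '' S := heq ▸ ⟨_, h'.mem_left.2, rfl⟩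
    obtain ⟨he1, he2⟩ := Prod.ext_iff.1 he
    have e1 : ∀ {a b : ℝ}, a ∈ Ioo (0 : ℝ) 1 → (b = 0 ∨ b = 1) → (a : UnitAddCircle) ≠ b := by
      rintro a b ha (rfl | rfl) h
      · exact ha.1.ne' (eq_of_coe_unitAddCircle_eq ha (by simp) h)
      · exact ha.2.ne (eq_of_coe_unitAddCircle_eq ha (by simp) h)
    -- Only `(x, 1)` and `(x, 0)` have a second coordinate that is trivial on the circle.
    rcases h.mem_cases hz with rfl | rfl | rfl | rfl | hz
    · exact absurd he2 (e1 hy (Or.inr rfl))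
    · exact eq_of_coe_unitAddCircle_eq hx' (Ioo_subset_Icc_self hx) he1.symm
    · exact eq_of_coe_unitAddCircle_eq hx' (Ioo_subset_Icc_self hx) he1.symm
    · exact absurd he2 (e1 hy (Or.inr rfl))
    · exact absurd he2 (e1 hz.2 (Or.inr rfl))
  · obtain ⟨z, hz, he⟩ : toTorus (0, y') ∈ toTorus '' S := heq ▸ ⟨_, h'.mem_left.1, rfl⟩
    obtain ⟨he1, he2⟩ := Prod.ext_iff.1 he
    have e1 : ∀ {a b : ℝ}, a ∈ Ioo (0 : ℝ) 1 → (b = 0 ∨ b = 1) → (a : UnitAddCircle) ≠ b := by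
      rintro a b ha (rfl | rfl) h
      · exact ha.1.ne' (eq_of_coe_unitAddCircle_eq ha (by simp) h)
      · exact ha.2.ne (eq_of_coe_unitAddCircle_eq ha (by simp) h)
    rcases h.mem_cases hz with rfl | rfl | rfl | rfl | hz
    · exact eq_of_coe_unitAddCircle_eq hy' (Ioo_subset_Icc_self hy) he2.symm
    · exact absurd he1 (e1 hx (Or.inl rfl))
    · exact absurd he1 (e1 hx (Or.inl rfl))
    · exact eq_of_coe_unitAddCircle_eq hy' (Ioo_subset_Icc_self hy) he2.symm
    · exact absurd he1 (e1 hz.1 (Or.inl rfl))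

/-- All four transition points of an aba cycle are transversal to the boundary. -/
theorem IsABACycle.grad_ne_zero {x y : ℝ} {S : Set (ℝ × ℝ)} (h : IsABACycle H x y S) :
    (grad H (0, y)).2 ≠ 0 ∧ (grad H (1, y)).2 ≠ 0 ∧ (grad H (x, 0)).1 ≠ 0 ∧
      (grad H (x, 1)).1 ≠ 0 := by
  have h1 := (sewn_horizontal_iff.1 h.1).2.ne'
  have h2 := (sewn_vertical_iff.1 h.2.1).2.ne'
  exact ⟨right_ne_zero_of_mul h2, left_ne_zero_of_mul h2, right_ne_zero_of_mul h1,
    left_ne_zero_of_mul h1⟩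

theorem IsABACycle.dot_ne_zero {x y : ℝ} {S : Set (ℝ × ℝ)} (h : IsABACycle H x y S) :
    dot (X H (0, y)) (inwardNormal (0, y)) ≠ 0 ∧ dot (X H (1, y)) (inwardNormal (1, y)) ≠ 0 ∧
      dot (X H (x, 0)) (inwardNormal (x, 0)) ≠ 0 ∧
      dot (X H (x, 1)) (inwardNormal (x, 1)) ≠ 0 := by
  have hx := (sewn_horizontal_iff.1 h.1).1
  rw [inwardNormal_zero_left, inwardNormal_one_left, inwardNormal_zero_right hx,
    inwardNormal_one_right hx]
  simpa [dot, X] using h.grad_ne_zero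

/-- An aba cycle is determined by its transition points. -/
theorem IsABACycle.unique {x y : ℝ} {S S' : Set (ℝ × ℝ)} (h : IsABACycle H x y S)
    (h' : IsABACycle H x y S') : S = S' := by
  -- Opposite directions of travel would make `(0, y)` both an entry and an exit point, forcing the
  -- normal component there to vanish.
  have hne := h.dot_ne_zero.1
  obtain ⟨h1, h2, S₁, S₂, rfl, ⟨hS1, hS2⟩ | ⟨hS1, hS2⟩⟩ := h <;>
    obtain ⟨h1', h2', S₁', S₂', rfl, ⟨hS1', hS2'⟩ | ⟨hS1', hS2'⟩⟩ := h'
  · rw [hS1.unique hS1', hS2.unique hS2']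
  · exact absurd (le_antisymm hS1'.dot_end_nonpos hS1.dot_start_nonneg) hne
  · exact absurd (le_antisymm hS1.dot_end_nonpos hS1'.dot_start_nonneg) hne
  · rw [hS1.unique hS1', hS2.unique hS2']

/-- Every solution of the transition equations near an aba cycle belongs to a nearby aba cycle. -/
theorem IsABACycle.exists_perturbation {x y : ℝ} {S : Set (ℝ × ℝ)} (h : IsABACycle H x y S)
    {ε : ℝ} (hε : 0 < ε) :
    ∃ δ > 0, ∀ x' y', dist x' x < δ → dist y' y < δ → value H (0, y') = value H (x', 1) →
      value H (x', 0) = value H (1, y') →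
      ∃ S', IsABACycle H x' y' S' ∧ S' ⊆ Metric.thickening ε S := by
  have hx := (sewn_horizontal_iff.1 h.1).1
  have hy := (sewn_vertical_iff.1 h.2.1).1
  obtain ⟨d1, d2, d3, d4⟩ := h.dot_ne_zero
  -- Sewing is an open condition along an edge.
  obtain ⟨δ₁, hδ₁, hsx⟩ : ∃ r > 0, ∀ x', dist x' x < r → Sewn H (x', 1) (x', 0) := by
    refine Metric.eventually_nhds_iff.1 ?_
    have hc : Continuous fun t => (grad H (t, 1)).1 * (grad H (t, 0)).1 := by
      have := continuous_value (MvPolynomial.pderiv 0 H)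
      simp only [grad]
      fun_prop
    filter_upwards [Ioo_mem_nhds hx.1 hx.2, (hc.tendsto x).eventually
      (lt_mem_nhds (sewn_horizontal_iff.1 h.1).2)] with t h1 h2
    exact sewn_horizontal_iff.2 ⟨h1, h2⟩
  obtain ⟨δ₂, hδ₂, hsy⟩ : ∃ r > 0, ∀ y', dist y' y < r → Sewn H (1, y') (0, y') := by
    refine Metric.eventually_nhds_iff.1 ?_
    have hc : Continuous fun t => (grad H (1, t)).2 * (grad H (0, t)).2 := by
      have := continuous_value (MvPolynomial.pderiv 1 H)
      simp only [grad]
      fun_prop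
    filter_upwards [Ioo_mem_nhds hy.1 hy.2, (hc.tendsto y).eventually
      (lt_mem_nhds (sewn_vertical_iff.1 h.2.1).2)] with t h1 h2
    exact sewn_vertical_iff.2 ⟨h1, h2⟩
  have n1 : ∀ y', normalComponent (0, y) ((0, y') - (0, y)) = 0 := fun y' => by
    simp [normalComponent_apply, inwardNormal_zero_left, dot]
  have n2 : ∀ y', normalComponent (1, y) ((1, y') - (1, y)) = 0 := fun y' => by
    simp [normalComponent_apply, inwardNormal_one_left, dot]
  have n3 : ∀ x', normalComponent (x, 0) ((x', 0) - (x, 0)) = 0 := fun y' => by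
    simp [normalComponent_apply, inwardNormal_zero_right hx, dot]
  have n4 : ∀ x', normalComponent (x, 1) ((x', 1) - (x, 1)) = 0 := fun y' => by
    simp [normalComponent_apply, inwardNormal_one_right hx, dot]
  have D1 : ∀ a b c : ℝ, dist (c, a) (c, b) = dist a b := fun a b c => by simp [Prod.dist_eq]
  have D2 : ∀ a b c : ℝ, dist (a, c) (b, c) = dist a b := fun a b c => by simp [Prod.dist_eq]
  obtain ⟨h1, h2, S₁, S₂, rfl, ⟨hS1, hS2⟩ | ⟨hS1, hS2⟩⟩ := h
  · obtain ⟨δ₃, hδ₃, P1⟩ := hS1.exists_perturbation d1 d4 hε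
    obtain ⟨δ₄, hδ₄, P2⟩ := hS2.exists_perturbation d3 d2 hε
    refine ⟨min (min δ₁ δ₂) (min δ₃ δ₄), by positivity, fun x' y' hx' hy' e1 e2 => ?_⟩
    simp only [lt_min_iff] at hx' hy'
    obtain ⟨S₁', hS1', hn1⟩ := P1 (0, y') (x', 1) (by rw [D1]; exact hy'.2.1)
      (by rw [D2]; exact hx'.2.1) (n1 y') (n4 x') e1
    obtain ⟨S₂', hS2', hn2⟩ := P2 (x', 0) (1, y') (by rw [D2]; exact hx'.2.2)
      (by rw [D1]; exact hy'.2.2) (n3 x') (n2 y') e2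
    refine ⟨S₁' ∪ S₂', ⟨hsx _ hx'.1.1, hsy _ hy'.1.2, S₁', S₂', rfl, Or.inl ⟨hS1', hS2'⟩⟩, ?_⟩
    rw [Metric.thickening_union]
    exact union_subset_union hn1 hn2
  · obtain ⟨δ₃, hδ₃, P1⟩ := hS1.exists_perturbation d4 d1 hε
    obtain ⟨δ₄, hδ₄, P2⟩ := hS2.exists_perturbation d2 d3 hε
    refine ⟨min (min δ₁ δ₂) (min δ₃ δ₄), by positivity, fun x' y' hx' hy' e1 e2 => ?_⟩
    simp only [lt_min_iff] at hx' hy'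
    obtain ⟨S₁', hS1', hn1⟩ := P1 (x', 1) (0, y') (by rw [D2]; exact hx'.2.1)
      (by rw [D1]; exact hy'.2.1) (n4 x') (n1 y') e1.symm
    obtain ⟨S₂', hS2', hn2⟩ := P2 (1, y') (x', 0) (by rw [D1]; exact hy'.2.2)
      (by rw [D2]; exact hx'.2.2) (n2 y') (n3 x') e2.symm
    refine ⟨S₁' ∪ S₂', ⟨hsx _ hx'.1.1, hsy _ hy'.1.2, S₁', S₂', rfl, Or.inr ⟨hS1', hS2'⟩⟩, ?_⟩
    rw [Metric.thickening_union]
    exact union_subset_union hn1 hn2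

/-- The transition points of an aba limit cycle are an isolated solution of the transition
equations. -/
theorem IsABALimitCycle.isolated {x y : ℝ} {S : Set (ℝ × ℝ)} (h : IsABALimitCycle H x y S) :
    ∃ δ > 0, ∀ x' y', dist x' x < δ → dist y' y < δ → value H (0, y') = value H (x', 1) →
      value H (x', 0) = value H (1, y') → x' = x ∧ y' = y := by
  obtain ⟨hc, -, U, hU, hSU, huniq⟩ := h
  -- The isolating neighbourhood is pulled back to the plane, where compactness of the trace gives a
  -- uniform `ε`.
  obtain ⟨ε, hε, hεU⟩ := hc.isCompact.exists_thickening_subset_open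
    (hU.preimage continuous_toTorus) (image_subset_iff.1 hSU)
  obtain ⟨δ, hδ, hp⟩ := hc.exists_perturbation hε
  refine ⟨δ, hδ, fun x' y' hx' hy' e1 e2 => ?_⟩
  obtain ⟨S', hS', hsub⟩ := hp x' y' hx' hy' e1 e2
  exact hc.transition_eq hS' (huniq _ hS'.isCrossingClosedOrbit
    (image_subset_iff.2 (hsub.trans hεU)))

end TorusPSVF

end

/-! ### The degree drop, and Bézout's bound in the presence of common components. -/

section

open MvPolynomial

namespace TorusPSVF

theorem totalDegree_bind₁_le {l : Fin 2 → MvPolynomial (Fin 2) ℝ} (hl : ∀ i, (l i).totalDegree ≤ 1)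
    (H : MvPolynomial (Fin 2) ℝ) : (bind₁ l H).totalDegree ≤ H.totalDegree := by
  conv_lhs => rw [H.as_sum, map_sum]
  refine totalDegree_finsetSum_le fun d hd => ?_
  rw [bind₁_monomial]
  refine (totalDegree_mul _ _).trans ?_
  rw [totalDegree_C, zero_add]
  refine (totalDegree_finsetProd _ _).trans ((Finset.sum_le_sum fun i _ => ?_).trans
    (le_totalDegree hd))
  refine (totalDegree_pow _ _).trans ?_
  simpa using Nat.mul_le_mul_left (d i) (hl i)

theorem bind₁_pair_monomial (a b : MvPolynomial (Fin 2) ℝ) (d : Fin 2 →₀ ℕ) (r : ℝ) :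
    bind₁ ![a, b] (monomial d r) = C r * (a ^ d 0 * b ^ d 1) := by
  rw [← aeval_eq_bind₁, aeval_monomial, Finsupp.prod_fintype _ _ (by simp)]
  simp [MvPolynomial.algebraMap_eq]

/-- The polynomial `H(0, y) - H(x, 1)`. -/
noncomputable def transitionLeft (H : MvPolynomial (Fin 2) ℝ) : MvPolynomial (Fin 2) ℝ :=
  bind₁ ![0, MvPolynomial.X 1] H - bind₁ ![MvPolynomial.X 0, 1] H

/-- The polynomial `H(x, 0) - H(1, y)`. -/
noncomputable def transitionRight (H : MvPolynomial (Fin 2) ℝ) : MvPolynomial (Fin 2) ℝ :=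
  bind₁ ![MvPolynomial.X 0, 0] H - bind₁ ![1, MvPolynomial.X 1] H

theorem eval_bind₁_pair (H a b : MvPolynomial (Fin 2) ℝ) (v : Fin 2 → ℝ) :
    eval v (bind₁ ![a, b] H) = value H (eval v a, eval v b) := by
  rw [value, ← eval₂_id, eval₂_id, ← aeval_eq_eval, aeval_bind₁, ← aeval_eq_eval]
  congr 2
  ext i
  fin_cases i <;> simp

theorem eval_transitionLeft (H : MvPolynomial (Fin 2) ℝ) (v : Fin 2 → ℝ) :
    eval v (transitionLeft H) = value H (0, v 1) - value H (v 0, 1) := by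
  simp [transitionLeft, eval_bind₁_pair]

theorem eval_transitionRight (H : MvPolynomial (Fin 2) ℝ) (v : Fin 2 → ℝ) :
    eval v (transitionRight H) = value H (v 0, 0) - value H (1, v 1) := by
  simp [transitionRight, eval_bind₁_pair]

theorem totalDegree_transitionLeft_le (H : MvPolynomial (Fin 2) ℝ) :
    (transitionLeft H).totalDegree ≤ H.totalDegree := by
  refine (totalDegree_sub _ _).trans (max_le ?_ ?_) <;> refine totalDegree_bind₁_le (fun i => ?_) H
    <;> fin_cases i <;> simp

/-- A monomial `x^i y^j` contributes `0` if `i = j = 0`, the constant `-1` if exactly one exponent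
is zero, and `-x^i - y^j` otherwise; in the last case `i` and `j` are each less than `i + j`. -/
theorem totalDegree_transition_add_le (H : MvPolynomial (Fin 2) ℝ) :
    (transitionLeft H + transitionRight H).totalDegree ≤ H.totalDegree - 1 := by
  have key : transitionLeft H + transitionRight H = ∑ d ∈ H.support, C (coeff d H) *
      (0 ^ d 0 * MvPolynomial.X 1 ^ d 1 - MvPolynomial.X 0 ^ d 0 + (MvPolynomial.X 0 ^ d 0 * 0 ^ d 1 - MvPolynomial.X 1 ^ d 1)) := by
    unfold transitionLeft transitionRight
    conv_lhs => rw [H.as_sum]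
    simp only [map_sum, ← Finset.sum_sub_distrib, ← Finset.sum_add_distrib]
    refine Finset.sum_congr rfl fun d _ => ?_
    simp only [bind₁_pair_monomial]
    ring
  rw [key]
  refine totalDegree_finsetSum_le fun d hd => (totalDegree_mul _ _).trans ?_
  rw [totalDegree_C, zero_add]
  have hdeg : d 0 + d 1 ≤ H.totalDegree := by
    have := le_totalDegree hd
    rwa [Finsupp.sum_fintype _ _ (by simp), Fin.sum_univ_two] at this
  rcases Nat.eq_zero_or_pos (d 0) with h0 | h0 <;> rcases Nat.eq_zero_or_pos (d 1) with h1 | h1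
  · simp [h0, h1]
  · have : (0 ^ d 0 * MvPolynomial.X 1 ^ d 1 - MvPolynomial.X 0 ^ d 0 + (MvPolynomial.X 0 ^ d 0 * 0 ^ d 1 - MvPolynomial.X 1 ^ d 1) :
        MvPolynomial (Fin 2) ℝ) = C (-1) := by
      simp [h0, h1.ne']
      ring
    rw [this, totalDegree_C]
    exact Nat.zero_le _
  · have : (0 ^ d 0 * MvPolynomial.X 1 ^ d 1 - MvPolynomial.X 0 ^ d 0 + (MvPolynomial.X 0 ^ d 0 * 0 ^ d 1 - MvPolynomial.X 1 ^ d 1) :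
        MvPolynomial (Fin 2) ℝ) = C (-1) := by
      simp [h1, h0.ne']
      ring
    rw [this, totalDegree_C]
    exact Nat.zero_le _
  · have : (0 ^ d 0 * MvPolynomial.X 1 ^ d 1 - MvPolynomial.X 0 ^ d 0 + (MvPolynomial.X 0 ^ d 0 * 0 ^ d 1 - MvPolynomial.X 1 ^ d 1) :
        MvPolynomial (Fin 2) ℝ) = -MvPolynomial.X 0 ^ d 0 - MvPolynomial.X 1 ^ d 1 := by simp [h1.ne', h0.ne']; ring
    rw [this]
    refine (totalDegree_sub _ _).trans (max_le ?_ ?_)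
    · rw [totalDegree_neg, totalDegree_X_pow]
      omega
    · rw [totalDegree_X_pow]
      omega

theorem hasDerivAt_eval_update (P : MvPolynomial (Fin 2) ℝ) (x y : ℝ) :
    HasDerivAt (fun t => value P (x, t)) (grad P (x, y)).2 y := by
  refine ((hasStrictFDerivAt_value P (x, y)).hasFDerivAt.comp_hasDerivAt y
    ((hasDerivAt_const y x).prodMk (hasDerivAt_id y))).congr_deriv ?_
  simp

/-- A zero of a polynomial with nonzero `y`-derivative is not isolated. -/
theorem exists_zero_near {G : MvPolynomial (Fin 2) ℝ} {x y : ℝ} (h0 : value G (x, y) = 0)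
    (hd : (grad G (x, y)).2 ≠ 0) {δ : ℝ} (hδ : 0 < δ) :
    ∃ x' y', dist x' x < δ ∧ dist y' y < δ ∧ x' ≠ x ∧ value G (x', y') = 0 := by
  wlog hpos : 0 < (grad G (x, y)).2 generalizing G
  · obtain ⟨x', y', h1, h2, h3, h4⟩ := this (G := -G) (by simpa [value] using h0)
      (by simpa [grad, value] using hd)
      (by
        have := lt_of_le_of_ne (not_lt.1 hpos) hd
        simpa [grad, value] using this)
    exact ⟨x', y', h1, h2, h3, by simpa [value] using h4⟩
  have hder := hasDerivAt_eval_update G x y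
  have hslope := (hasDerivAt_iff_tendsto_slope.1 hder).eventually (lt_mem_nhds hpos)
  obtain ⟨ρ, hρ, hs⟩ := Metric.eventually_nhds_iff.1 (eventually_nhdsWithin_iff.1 hslope)
  obtain ⟨η, hη, hη'⟩ := exists_between (lt_min hρ hδ)
  rw [lt_min_iff] at hη'
  have hup : 0 < value G (x, y + η) := by
    have := hs (y := y + η) (by simp [abs_of_pos hη, hη'.1]) (by simp [hη.ne'])
    rw [slope_def_field, h0] at this
    simpa [hη] using this
  have hdown : value G (x, y - η) < 0 := by
    have := hs (y := y - η) (by simp [abs_of_pos hη, hη'.1]) (by simp [hη.ne'])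
    rw [slope_def_field, h0, sub_zero, sub_sub_cancel_left, div_neg, neg_pos] at this
    simpa using (div_lt_iff₀ hη).1 this
  have hcG := continuous_value G
  have hc1 : Continuous fun t => value G (t, y + η) := by fun_prop
  have hc2 : Continuous fun t => value G (t, y - η) := by fun_prop
  have hev := ((hc1.tendsto x).eventually (lt_mem_nhds hup)).and
    ((hc2.tendsto x).eventually (gt_mem_nhds hdown))
  obtain ⟨r, hr, hrs⟩ := Metric.eventually_nhds_iff.1 hev
  -- The sign change of `G` between heights `y - η` and `y + η` survives on the vertical line
  -- through `x + s`, which yields a zero off the line through `x`.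
  obtain ⟨s, hs0, hs1⟩ := exists_between (lt_min hr hδ)
  rw [lt_min_iff] at hs1
  obtain ⟨h1, h2⟩ := hrs (y := x + s) (by simp [abs_of_pos hs0, hs1.1])
  obtain ⟨y', hy', hz⟩ : (0 : ℝ) ∈ (fun t => value G (x + s, t)) '' Set.Icc (y - η) (y + η) :=
    intermediate_value_Icc (by linarith) (by fun_prop) ⟨h2.le, h1.le⟩
  refine ⟨x + s, y', by simp [abs_of_pos hs0, hs1.2], ?_, by simp [hs0.ne'], hz⟩
  rw [Real.dist_eq, abs_lt]
  constructor <;> linarith [hy'.1, hy'.2]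

/-- A form of Bézout's bound that allows common components: isolated real common zeros that are
nonsingular on the first curve. -/
theorem encard_isolated_zeros_le (P R : MvPolynomial (Fin 2) ℝ) :
    {v : Fin 2 → ℝ | eval v P = 0 ∧ eval v R = 0 ∧ (grad P (v 0, v 1)).2 ≠ 0 ∧
      ∃ δ > 0, ∀ x' y' : ℝ, dist x' (v 0) < δ → dist y' (v 1) < δ → value P (x', y') = 0 →
        value R (x', y') = 0 → x' = v 0 ∧ y' = v 1}.encard
      ≤ ((P.totalDegree * R.totalDegree : ℕ) : ℕ∞) := by
  have hvec : ∀ v : Fin 2 → ℝ, ![v 0, v 1] = v := fun v => by ext i; fin_cases i <;> rfl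
  -- Here the derivative condition fails everywhere, so the set is empty.
  by_cases hP : P = 0
  · subst hP
    simp [grad, value]
  obtain ⟨P', R', G, hrel, rfl, rfl⟩ :=
    UniqueFactorizationMonoid.exists_reduced_factors P hP R
  have hG : G ≠ 0 := left_ne_zero_of_mul hP
  have hP' : P' ≠ 0 := right_ne_zero_of_mul hP
  have hsub : {v : Fin 2 → ℝ | eval v (G * P') = 0 ∧ eval v (G * R') = 0 ∧
      (grad (G * P') (v 0, v 1)).2 ≠ 0 ∧
      ∃ δ > 0, ∀ x' y' : ℝ, dist x' (v 0) < δ → dist y' (v 1) < δ → value (G * P') (x', y') = 0 →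
        value (G * R') (x', y') = 0 → x' = v 0 ∧ y' = v 1} ⊆
      {v | eval v P' = 0 ∧ eval v R' = 0} := by
    rintro v ⟨h1, h2, h3, δ, hδ, h4⟩
    -- Where `G` vanishes, the `y`-derivative of `G * P'` is `P'` times that of `G`, so the latter
    -- is nonzero and the zeros of `G`, all common zeros, accumulate at `v`.
    have hGv : eval v G ≠ 0 := by
      intro hGv
      have hG0 : value G (v 0, v 1) = 0 := by rw [value, hvec]; exact hGv
      have hd : (grad G (v 0, v 1)).2 ≠ 0 := by
        intro hd
        refine h3 ?_
        simp only [grad, value, Derivation.leibniz, smul_eq_mul, map_add, map_mul] at hd hG0 ⊢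
        simp [hd, hG0]
      obtain ⟨x', y', hx', hy', hne, hz⟩ := exists_zero_near hG0 hd hδ
      refine hne (h4 x' y' hx' hy' ?_ ?_).1
      · simp only [value, map_mul] at hz ⊢
        rw [hz, zero_mul]
      · simp only [value, map_mul] at hz ⊢
        rw [hz, zero_mul]
    rw [map_mul] at h1 h2
    exact ⟨(mul_eq_zero.1 h1).resolve_left hGv, (mul_eq_zero.1 h2).resolve_left hGv⟩
  refine (Set.encard_le_encard hsub).trans ?_
  -- Being coprime to `0` makes `P'` a unit, which has no zeros.
  by_cases hR' : R' = 0
  · subst hR'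
    have hu : IsUnit P' := isRelPrime_zero_right.1 hrel
    have : {v : Fin 2 → ℝ | eval v P' = 0 ∧ eval v (0 : MvPolynomial (Fin 2) ℝ) = 0} = ∅ := by
      ext v
      simp [(hu.map (eval v)).ne_zero]
    rw [this]
    simp
  · refine (encard_setOf_eval_eq_zero_le hP' hR' hrel).trans ?_
    rw [totalDegree_mul_of_isDomain hG hP', totalDegree_mul_of_isDomain hG hR']
    exact_mod_cast Nat.mul_le_mul (Nat.le_add_left _ _) (Nat.le_add_left _ _)

end TorusPSVF

end

/-! ### Counting the limit cycles. -/

open MvPolynomial in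
theorem TorusPSVF.grad_transitionLeft_snd (H : MvPolynomial (Fin 2) ℝ) (x y : ℝ) :
    (grad (transitionLeft H) (x, y)).2 = (grad H (0, y)).2 := by
  refine (hasDerivAt_eval_update (transitionLeft H) x y).unique ?_
  have h : (fun t => value (transitionLeft H) (x, t)) =
      fun t => value H (0, t) - value H (x, 1) := by
    ext t
    rw [value, eval_transitionLeft]
    simp
  rw [h]
  exact (hasDerivAt_eval_update H 0 y).sub_const _

theorem theorem4 (n : ℕ) (H : MvPolynomial (Fin 2) ℝ) (hdeg : H.totalDegree = n)
    (hH0 : TorusPSVF.value H (0, 0) = 0)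
    (hgrad : ∀ (x y : ℝ) (S : Set (ℝ × ℝ)), TorusPSVF.IsABALimitCycle H x y S →
      ∃ m : ℝ, 0 < m ∧ ∀ p ∈ S,
        m ≤ Real.sqrt (TorusPSVF.dot (TorusPSVF.grad H p) (TorusPSVF.grad H p)))
    (htrans : ∀ (x y : ℝ) (S : Set (ℝ × ℝ)), TorusPSVF.IsABALimitCycle H x y S →
      ∀ p ∈ ({(0, y), (x, 1), (x, 0), (1, y)} : Set (ℝ × ℝ)),
        TorusPSVF.dot (TorusPSVF.X H p) (TorusPSVF.inwardNormal p) ≠ 0) :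
    {γ : Set TorusPSVF.Torus | ∃ (x y : ℝ) (S : Set (ℝ × ℝ)),
      TorusPSVF.IsABALimitCycle H x y S ∧ γ = TorusPSVF.toTorus '' S}.encard
      ≤ ((n * (n - 1) : ℕ) : ℕ∞) := by
  classical
  subst hdeg
  set P := TorusPSVF.transitionLeft H with hPdef
  -- Together with `P = 0` the sum encodes the same system as the second equation, at a lower
  -- degree.
  set R := TorusPSVF.transitionLeft H + TorusPSVF.transitionRight H with hRdef
  have hP : ∀ x y, TorusPSVF.value P (x, y) =
      TorusPSVF.value H (0, y) - TorusPSVF.value H (x, 1) := fun x y => by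
    rw [TorusPSVF.value, hPdef, TorusPSVF.eval_transitionLeft]
    simp
  have hR : ∀ x y, TorusPSVF.value R (x, y) =
      TorusPSVF.value H (0, y) - TorusPSVF.value H (x, 1) +
        (TorusPSVF.value H (x, 0) - TorusPSVF.value H (1, y)) := fun x y => by
    rw [TorusPSVF.value, hRdef, map_add, TorusPSVF.eval_transitionLeft,
      TorusPSVF.eval_transitionRight]
    simp
  -- The limit cycles lie in the image of the isolated zeros under `f`; the choice of trace is
  -- immaterial by `IsABACycle.unique`, and `∅` is a default value.
  let f : (Fin 2 → ℝ) → Set TorusPSVF.Torus := fun v =>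
    if h : ∃ S, TorusPSVF.IsABALimitCycle H (v 0) (v 1) S then TorusPSVF.toTorus '' h.choose else ∅
  have hbound : ((P.totalDegree * R.totalDegree : ℕ) : ℕ∞) ≤
      ((H.totalDegree * (H.totalDegree - 1) : ℕ) : ℕ∞) := by
    exact_mod_cast Nat.mul_le_mul (TorusPSVF.totalDegree_transitionLeft_le H)
      (TorusPSVF.totalDegree_transition_add_le H)
  refine le_trans ?_ ((TorusPSVF.encard_isolated_zeros_le P R).trans hbound)
  refine (Set.encard_le_encard ?_).trans (Set.encard_image_le f _)
  rintro γ ⟨x, y, S, hS, rfl⟩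
  refine ⟨![x, y], ?_, ?_⟩
  · obtain ⟨e1, e2⟩ := hS.1.value_eq
    obtain ⟨δ, hδ, hiso⟩ := hS.isolated
    refine ⟨?_, ?_, ?_, δ, hδ, fun x' y' hx' hy' h1 h2 => ?_⟩
    · exact (hP x y).trans (by rw [e1, sub_self])
    · exact (hR x y).trans (by rw [e1, e2, sub_self, sub_self, add_zero])
    · exact (TorusPSVF.grad_transitionLeft_snd H x y).trans_ne hS.1.grad_ne_zero.1
    · rw [hP] at h1
      rw [hR, h1, zero_add] at h2
      exact hiso x' y' hx' hy' (sub_eq_zero.1 h1) (sub_eq_zero.1 h2)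
  · have h : ∃ S, TorusPSVF.IsABALimitCycle H ((![x, y] : Fin 2 → ℝ) 0)
        ((![x, y] : Fin 2 → ℝ) 1) S := ⟨S, hS⟩
    have hf : f ![x, y] = TorusPSVF.toTorus '' h.choose := dif_pos h
    rw [hf, TorusPSVF.IsABACycle.unique h.choose_spec.1 hS.1]
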